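/- A Boolean relation of arity $n$ is a set $R\subseteq\{0,1\}^n$. It is $i$-valid ($i\in\{0,1\}$) if $(i,\dots,i)\in R$; it is horn (co-horn) if it is the set of vectors satisfying a finite conjunction of clauses, each of which has at most one positive (at most one negative) literal. Let $S$ be a possibly infinite class of Boolean relations, with no effectiveness requirement. An $S$-formula over a set of variables $V$ is an expression $R(y_1,\dots,y_n)$ with $R\in S$ of arity $n$ and $y_1,\dots,y_n\in V$. A set $C$ of such formulas is finitely satisfiable if every finite subset of $C$ is satisfied by some truth assignment, and a set $H\subseteq V$ is homogeneous for $C$ if there is a truth value $c$ such that every finite subset of $C$ is satisfied by a truth assignment that is constantly $c$ on $H$. $\mathrm{LRSAT}(S)$ is the following statement of second-order arithmetic: for every finitely satisfiable set $C$ of $S$-formulas over an infinite set of variables $V$ and every infinite $L\subseteq V$, there is an infinite set $H\subseteq L$ that is homogeneous for $C$. Let $[x\neq y]$ be the relation $\{(0,1),(1,0)\}$. Below, "$\mathsf{RCA}_0\vdash P$" means that $P$ holds in every model of $\mathsf{RCA}_0$. Theorem. Consider the conditions (a) every relation in $S$ is $0$-valid; (b) every relation in $S$ is $1$-valid; (c)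 every relation in $S$ is horn; (d) every relation in $S$ is co-horn. If $S$ satisfies one of (a)-(d), then $\mathsf{RCA}_0\vdash\mathrm{LRSAT}(S)$. If all relations in $S$ are non-empty and $S$ satisfies none of (a)-(d), then $\mathsf{RCA}_0\vdash \mathrm{LRSAT}(S)\rightarrow\mathrm{LRSAT}(\{[x\neq y]\})$. This holds for every class $S$ of (standard) Boolean relations, interpreted in a model of $\mathsf{RCA}_0$ by the codes of its members. It also holds inside every model of $\mathsf{RCA}_0$, for every class $S$ of Boolean relations in the sense of the model (the class need not be a set of the model, and its members may have nonstandard arity), the notions of non-empty, $0$-valid, $1$-valid, horn and co-horn relation being those of the model. -/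

import Mathlib

universe u

/-! ### Boolean relations -/

/-- A Boolean relation `R ⊆ {0,1}ⁿ` together with its arity `n`. -/
structure BoolRel where
  arity : ℕ
  carrier : Set (Fin arity → Bool)

/-- A clause over `n` variables: the disjunction of the variables in `pos` and of the negations of
the variables in `neg`. -/
structure BoolClause (n : ℕ) where
  pos : Finset (Fin n)
  neg : Finset (Fin n)

namespace BoolClause

def Holds {n : ℕ} (c : BoolClause n) (v : Fin n → Bool) : Prop :=
  (∃ i ∈ c.pos, v i = true) ∨ (∃ i ∈ c.neg, v i = false)

/-- At most one positive literal. -/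
def IsHorn {n : ℕ} (c : BoolClause n) : Prop := c.pos.card ≤ 1

/-- At most one negative literal. -/
def IsCoHorn {n : ℕ} (c : BoolClause n) : Prop := c.neg.card ≤ 1

end BoolClause

namespace BoolRel

/-- `R` is `b`-valid: it contains the constant vector `(b, …, b)`. -/
def IsValid (b : Bool) (R : BoolRel) : Prop := (fun _ => b) ∈ R.carrier

/-- `R` is defined by a finite conjunction of horn clauses. -/
def IsHorn (R : BoolRel) : Prop :=
  ∃ F : Finset (BoolClause R.arity),
    (∀ c ∈ F, c.IsHorn) ∧ ∀ v, v ∈ R.carrier ↔ ∀ c ∈ F, c.Holds v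

/-- `R` is defined by a finite conjunction of co-horn clauses. -/
def IsCoHorn (R : BoolRel) : Prop :=
  ∃ F : Finset (BoolClause R.arity),
    (∀ c ∈ F, c.IsCoHorn) ∧ ∀ v, v ∈ R.carrier ↔ ∀ c ∈ F, c.Holds v

/-- The relation `[x ≠ y]`. -/
def neq : BoolRel where
  arity := 2
  carrier := {v | v 0 ≠ v 1}

/-- All relations of `S` are `0`-valid, or all are `1`-valid, or all are horn, or all are
co-horn. -/
def Tame (S : Set BoolRel) : Prop :=
  (∀ R ∈ S, R.IsValid false) ∨ (∀ R ∈ S, R.IsValid true) ∨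
    (∀ R ∈ S, R.IsHorn) ∨ (∀ R ∈ S, R.IsCoHorn)

end BoolRel

/-! ### The language of second-order arithmetic -/

/-- Number terms; the variables are `var 0, var 1, …` (de Bruijn indices). -/
inductive NumTerm where
  | var (i : ℕ)
  | zero
  | one
  | add (s t : NumTerm)
  | mul (s t : NumTerm)

/-- Bounded quantifier formulas. `mem t i` says that `t` belongs to the `i`-th set variable, and
`ball t φ` is `∀ x < t, φ`, where `x` is variable `0` of `φ` and does not occur in `t`. The other
connectives and the bounded existential quantifier are abbreviations. -/
inductive BddFormula where
  | eq (s t : NumTerm)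
  | lt (s t : NumTerm)
  | mem (t : NumTerm) (i : ℕ)
  | neg (φ : BddFormula)
  | and (φ ψ : BddFormula)
  | ball (t : NumTerm) (φ : BddFormula)

/-- A structure for the language of second-order arithmetic: a first-order part, and a nonempty
collection of subsets of it over which the set variables range. -/
structure L2Structure : Type (u + 1) where
  Num : Type u
  zero : Num
  one : Num
  add : Num → Num → Num
  mul : Num → Num → Num
  lt : Num → Num → Prop
  sets : Set (Set Num)
  sets_nonempty : sets.Nonempty

namespace L2Structure

variable (M : L2Structure.{u})

instance : Zero M.Num := ⟨M.zero⟩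

instance : One M.Num := ⟨M.one⟩

instance : Add M.Num := ⟨M.add⟩

instance : Mul M.Num := ⟨M.mul⟩

instance : LT M.Num := ⟨M.lt⟩

variable {M}

/-- The valuation `a, e 0, e 1, …`. -/
def push (a : M.Num) (e : ℕ → M.Num) : ℕ → M.Num
  | 0 => a
  | k + 1 => e k

def termVal (e : ℕ → M.Num) : NumTerm → M.Num
  | .var i => e i
  | .zero => 0
  | .one => 1
  | .add s t => termVal e s + termVal e t
  | .mul s t => termVal e s * termVal e t

/-- Truth of a bounded quantifier formula under the set valuation `X` and the number
valuation `e`. -/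
def Sat (X : ℕ → Set M.Num) : BddFormula → (ℕ → M.Num) → Prop
  | .eq s t, e => termVal e s = termVal e t
  | .lt s t, e => termVal e s < termVal e t
  | .mem t i, e => termVal e t ∈ X i
  | .neg φ, e => ¬ Sat X φ e
  | .and φ ψ, e => Sat X φ e ∧ Sat X ψ e
  | .ball t φ, e => ∀ a, a < termVal e t → Sat X φ (push a e)

/-- `M` is a model of `RCA₀`: the basic axioms, `Σ⁰₁` induction and `Δ⁰₁` comprehension, the two
schemes with arbitrary number and set parameters. -/
structure IsModelRCA₀ (M : L2Structure.{u}) : Prop where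
  succ_ne_zero : ∀ n : M.Num, n + 1 ≠ 0
  succ_inj : ∀ m n : M.Num, m + 1 = n + 1 → m = n
  add_zero : ∀ m : M.Num, m + 0 = m
  add_succ : ∀ m n : M.Num, m + (n + 1) = (m + n) + 1
  mul_zero : ∀ m : M.Num, m * 0 = 0
  mul_succ : ∀ m n : M.Num, m * (n + 1) = m * n + m
  not_lt_zero : ∀ m : M.Num, ¬ m < 0
  lt_succ_iff : ∀ m n : M.Num, m < n + 1 ↔ m < n ∨ m = n
  sigma_induction : ∀ (φ : BddFormula) (X : ℕ → Set M.Num) (e : ℕ → M.Num),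
    (∀ i, X i ∈ M.sets) →
    (∃ m, Sat X φ (push m (push 0 e))) →
    (∀ n, (∃ m, Sat X φ (push m (push n e))) → ∃ m, Sat X φ (push m (push (n + 1) e))) →
    ∀ n, ∃ m, Sat X φ (push m (push n e))
  delta_comprehension : ∀ (φ ψ : BddFormula) (X : ℕ → Set M.Num) (e : ℕ → M.Num),
    (∀ i, X i ∈ M.sets) →
    (∀ n, (∃ m, Sat X φ (push m (push n e))) ↔ ∀ m, Sat X ψ (push m (push n e))) →
    {n | ∃ m, Sat X φ (push m (push n e))} ∈ M.sets

/-! ### Coding of finite objects inside a structure -/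

/-- The pair `(i, j)`, coded by `(i + j)² + i`. -/
def pair (i j : M.Num) : M.Num := (i + j) * (i + j) + i

/-- Membership in the finite set coded by `c`: the triple `(k, (m, n))` codes the set of all `i < k`
such that `m (i + 1) + 1` divides `n`. -/
def InCode (i c : M.Num) : Prop :=
  ∃ k m n, c = pair k (pair m n) ∧ i < k ∧ ∃ q, n = q * (m * (i + 1) + 1)

/-- `c` is the least code of the finite set that it codes, so that every finite set has exactly one
such code. -/
def IsFinCode (c : M.Num) : Prop :=
  ∀ d, d < c → ∃ i, ¬ (InCode i d ↔ InCode i c)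

/-- `a` codes a vector of `{0,1}ⁿ`, as the set of the coordinates at which it is `1`. -/
def IsVec (n a : M.Num) : Prop :=
  IsFinCode a ∧ ∀ i, InCode i a → i < n

/-- `ρ = (n, r)` codes an `n`-ary Boolean relation, `r` being the code of its set of vectors. -/
def IsRel (ρ : M.Num) : Prop :=
  ∃ n r, ρ = pair n r ∧ IsFinCode r ∧ ∀ a, InCode a r → IsVec n a

/-- `s` codes a sequence of length `n`, as a finite set of pairs `(i, yᵢ)` with `i < n`. -/
def IsSeq (n s : M.Num) : Prop :=
  IsFinCode s ∧ (∀ p, InCode p s → ∃ i y, i < n ∧ p = pair i y) ∧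
    ∀ i, i < n → ∃! y, InCode (pair i y) s

/-- `φ` codes a formula `R(y₀, …, yₙ₋₁)` with `R ∈ S` and all `yᵢ ∈ V`; the variables are numbers. -/
def IsFormulaOver (S V : Set M.Num) (φ : M.Num) : Prop :=
  ∃ n r s, φ = pair (pair n r) s ∧ pair n r ∈ S ∧ IsRel (pair n r) ∧ IsSeq n s ∧
    ∀ i y, InCode (pair i y) s → y ∈ V

/-- The truth assignment that makes exactly the variables in `ν` true satisfies `φ`. -/
def Satisfies (ν : Set M.Num) (φ : M.Num) : Prop :=
  ∃ n r s, φ = pair (pair n r) s ∧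
    ∃ a, InCode a r ∧ ∀ i y, InCode (pair i y) s → (InCode i a ↔ y ∈ ν)

/-! ### The principles `LRSAT(S)` -/

/-- `X` is infinite in the sense of the structure. -/
def IsInf (X : Set M.Num) : Prop := ∀ b, ∃ x ∈ X, b < x

/-- `D` is a finite set in the sense of the structure. -/
def IsFinSet (D : Set M.Num) : Prop := D ∈ M.sets ∧ ∃ b, ∀ x ∈ D, x < b

/-- Every finite subset of `C` is satisfiable. -/
def FinSatisfiable (C : Set M.Num) : Prop :=
  ∀ D, IsFinSet D → D ⊆ C → ∃ ν ∈ M.sets, ∀ φ ∈ D, Satisfies ν φ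

/-- For some truth value `c`, every finite subset of `C` is satisfied by an assignment with constant
value `c` on `H`. -/
def IsHomogeneous (C H : Set M.Num) : Prop :=
  ∃ c : Bool, ∀ D, IsFinSet D → D ⊆ C →
    ∃ ν ∈ M.sets, (∀ φ ∈ D, Satisfies ν φ) ∧ ∀ x ∈ H, (x ∈ ν ↔ c = true)

variable (M) in
/-- `LRSAT(S)` holds in `M`, where `S` is a class of codes of Boolean relations. -/
def LRSAT (S : Set M.Num) : Prop :=
  ∀ V ∈ M.sets, ∀ C ∈ M.sets, ∀ L ∈ M.sets,
    IsInf V → L ⊆ V → IsInf L → (∀ φ ∈ C, IsFormulaOver S V φ) → FinSatisfiable C →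
    ∃ H ∈ M.sets, H ⊆ L ∧ IsInf H ∧ IsHomogeneous C H

/-! ### Classes of Boolean relations inside a structure -/

variable (M) in
/-- The numeral of a standard natural number. -/
def num : ℕ → M.Num
  | 0 => 0
  | k + 1 => num k + 1

/-- `ρ` is the code in `M` of the Boolean relation `R`. -/
def Codes (ρ : M.Num) (R : BoolRel) : Prop :=
  IsRel ρ ∧ ∃ r, ρ = pair (M.num R.arity) r ∧
    ∀ v : Fin R.arity → Bool, v ∈ R.carrier ↔
      ∃ a, InCode a r ∧ ∀ i : Fin R.arity, (InCode (M.num i) a ↔ v i = true)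

variable (M) in
/-- The class of the codes in `M` of the relations in `S`. -/
def codesOf (S : Set BoolRel) : Set M.Num := {ρ | ∃ R ∈ S, Codes ρ R}

/-- The coded relation `ρ` has an element. -/
def RelNonempty (ρ : M.Num) : Prop :=
  ∃ n r, ρ = pair n r ∧ ∃ a, InCode a r

/-- The coded relation `ρ` contains the vector `(0, …, 0)`. -/
def RelZeroValid (ρ : M.Num) : Prop :=
  ∃ n r, ρ = pair n r ∧ ∃ a, InCode a r ∧ ∀ i, i < n → ¬ InCode i a

/-- The coded relation `ρ` contains the vector `(1, …, 1)`. -/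
def RelOneValid (ρ : M.Num) : Prop :=
  ∃ n r, ρ = pair n r ∧ ∃ a, InCode a r ∧ ∀ i, i < n → InCode i a

/-- `c = (p, q)` codes a clause over the variables `i < n`, with positive literals the `i` in `p`
and negative literals the `¬ i` for `i` in `q`. -/
def IsClause (n c : M.Num) : Prop :=
  ∃ p q, c = pair p q ∧ (∀ i, InCode i p → i < n) ∧ ∀ i, InCode i q → i < n

def ClauseHolds (c a : M.Num) : Prop :=
  ∃ p q, c = pair p q ∧ ((∃ i, InCode i p ∧ InCode i a) ∨ ∃ i, InCode i q ∧ ¬ InCode i a)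

/-- At most one positive literal. -/
def HornClause (c : M.Num) : Prop :=
  ∃ p q, c = pair p q ∧ ∀ i j, InCode i p → InCode j p → i = j

/-- At most one negative literal. -/
def CoHornClause (c : M.Num) : Prop :=
  ∃ p q, c = pair p q ∧ ∀ i j, InCode i q → InCode j q → i = j

/-- The coded relation `ρ` is defined by a coded finite set `f` of horn clauses. -/
def RelHorn (ρ : M.Num) : Prop :=
  ∃ n r, ρ = pair n r ∧ ∃ f, (∀ c, InCode c f → IsClause n c ∧ HornClause c) ∧
    ∀ a, IsVec n a → (InCode a r ↔ ∀ c, InCode c f → ClauseHolds c a)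

/-- The coded relation `ρ` is defined by a coded finite set `f` of co-horn clauses. -/
def RelCoHorn (ρ : M.Num) : Prop :=
  ∃ n r, ρ = pair n r ∧ ∃ f, (∀ c, InCode c f → IsClause n c ∧ CoHornClause c) ∧
    ∀ a, IsVec n a → (InCode a r ↔ ∀ c, InCode c f → ClauseHolds c a)

/-- All relations coded in `S` are `0`-valid, or all are `1`-valid, or all are horn, or all are
co-horn, in the sense of the structure. -/
def RelTame (S : Set M.Num) : Prop :=
  (∀ ρ ∈ S, RelZeroValid ρ) ∨ (∀ ρ ∈ S, RelOneValid ρ) ∨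
    (∀ ρ ∈ S, RelHorn ρ) ∨ (∀ ρ ∈ S, RelCoHorn ρ)

end L2Structure

/-- `RCA₀` proves `P`: the statement `P` holds in every model of `RCA₀`. -/
def RCA₀Proves (P : L2Structure.{u} → Prop) : Prop :=
  ∀ M : L2Structure.{u}, M.IsModelRCA₀ → P M


/-!
In the horn case, the intersection of models of finitely many formulas is a model; dually for
co-horn relations, so let `p` be `1` or `0` accordingly and compare models by their sets of
variables of value `p`. A variable is forced if it has the value `p` in all models of some finite
set of formulas, a `Σ⁰₁` property. Either the forced variables in `L` are unbounded, and an infinite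
set of them is homogeneous with value `p`, or those beyond some bound are not forced, hence have the
other value in the least model of each finite set of formulas.

If `S` is not tame, then a relation violating one of the four conditions, together with one or two
vectors in it, yields an `S`-formula in variables `x`, `z`, `t`, `f` that holds for `x ≠ z`,
`t = 1`, `f = 0`. For horn and co-horn this rests on the description of these relations as the ones
closed under minimum and maximum, which is proved inside the model. At most four such formulas
jointly imply `x ≠ z`, so they can replace the formulas of an instance of `LRSAT({[x ≠ y]})`.
-/
namespace L2Structure

section

variable {M : L2Structure.{u}}

/-! ### Bounded predicates -/

/-- The functions of a valuation that are given by a number term with parameters. -/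
class inductive BddTerm : ((ℕ → M.Num) → M.Num) → Prop
  | const (c : M.Num) : BddTerm fun _ => c
  | var (i : ℕ) : BddTerm fun e => e i
  | add (f g : (ℕ → M.Num) → M.Num) (hf : BddTerm f) (hg : BddTerm g) :
      BddTerm fun e => f e + g e
  | mul (f g : (ℕ → M.Num) → M.Num) (hf : BddTerm f) (hg : BddTerm g) :
      BddTerm fun e => f e * g e

/-- The properties of a valuation that are given by a bounded quantifier formula with parameters.
Instance resolution recognizes them, which spares us from writing down codes of formulas. -/
class inductive BddPred : ((ℕ → M.Num) → Prop) → Prop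
  | eq (f g : (ℕ → M.Num) → M.Num) (hf : BddTerm f) (hg : BddTerm g) :
      BddPred fun e => f e = g e
  | lt (f g : (ℕ → M.Num) → M.Num) (hf : BddTerm f) (hg : BddTerm g) :
      BddPred fun e => f e < g e
  | mem (f : (ℕ → M.Num) → M.Num) (Y : Set M.Num) (hf : BddTerm f) (hY : Y ∈ M.sets) :
      BddPred fun e => f e ∈ Y
  | not (P : (ℕ → M.Num) → Prop) (hP : BddPred P) : BddPred fun e => ¬ P e
  | and (P Q : (ℕ → M.Num) → Prop) (hP : BddPred P) (hQ : BddPred Q) : BddPred fun e => P e ∧ Q e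
  | ball (f : (ℕ → M.Num) → M.Num) (P : (ℕ → M.Num) → M.Num → Prop) (hf : BddTerm f)
      (hP : BddPred fun e => P (fun i => e (i + 1)) (e 0)) : BddPred fun e => ∀ a, a < f e → P e a

attribute [instance] BddTerm.const BddTerm.var

section

variable (f g : (ℕ → M.Num) → M.Num) (P Q : (ℕ → M.Num) → Prop)
  [hf : BddTerm f] [hg : BddTerm g] [hP : BddPred P] [hQ : BddPred Q]

instance : BddTerm fun e => f e + g e := .add f g hf hg

instance : BddTerm fun e => f e * g e := .mul f g hf hg

instance : BddPred fun e => f e = g e := .eq f g hf hg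

instance : BddPred fun e => f e < g e := .lt f g hf hg

instance (Y : Set M.Num) [hY : Fact (Y ∈ M.sets)] : BddPred fun e => f e ∈ Y := .mem f Y hf hY.out

instance : BddPred fun e => ¬ P e := .not P hP

instance : BddPred fun e => P e ∧ Q e := .and P Q hP hQ

instance (P : (ℕ → M.Num) → M.Num → Prop) [hP : BddPred fun e => P (fun i => e (i + 1)) (e 0)] :
    BddPred fun e => ∀ a, a < f e → P e a := .ball f P hf hP

end

/-- The parameters of a term are enumerated by the part of the valuation beyond `k`. -/
theorem BddTerm.exists_term {f : (ℕ → M.Num) → M.Num} (hf : BddTerm f) :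
    ∃ A : Set M.Num, A.Countable ∧ ∀ (k : ℕ) (e : ℕ → M.Num), A ⊆ Set.range e →
      ∃ t, ∀ w : ℕ → M.Num, (∀ i, w (i + k) = e i) → termVal w t = f w := by
  induction hf with
  | const c =>
    refine ⟨{c}, Set.countable_singleton c, fun k e hA => ?_⟩
    obtain ⟨i, rfl⟩ := hA rfl
    exact ⟨.var (i + k), fun w hw => hw i⟩
  | var i => exact ⟨∅, Set.countable_empty, fun k e _ => ⟨.var i, fun w _ => rfl⟩⟩
  | add f g _ _ ihf ihg | mul f g _ _ ihf ihg =>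
    obtain ⟨A, hA, hf⟩ := ihf
    obtain ⟨B, hB, hg⟩ := ihg
    refine ⟨A ∪ B, hA.union hB, fun k e hAB => ?_⟩
    obtain ⟨s, hs⟩ := hf k e (Set.subset_union_left.trans hAB)
    obtain ⟨t, ht⟩ := hg k e (Set.subset_union_right.trans hAB)
    first
      | exact ⟨.add s t, fun w hw => congrArg₂ (· + ·) (hs w hw) (ht w hw)⟩
      | exact ⟨.mul s t, fun w hw => congrArg₂ (· * ·) (hs w hw) (ht w hw)⟩

namespace BddPred

theorem exists_formula {P : (ℕ → M.Num) → Prop} (hP : BddPred P) :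
    ∃ (A : Set M.Num) (B : Set (Set M.Num)), A.Countable ∧ B.Countable ∧ B ⊆ M.sets ∧
      ∀ (k : ℕ) (e : ℕ → M.Num) (X : ℕ → Set M.Num), A ⊆ Set.range e → B ⊆ Set.range X →
        ∃ φ, ∀ w : ℕ → M.Num, (∀ i, w (i + k) = e i) → (Sat X φ w ↔ P w) := by
  induction hP with
  | eq f g hf hg | lt f g hf hg =>
    obtain ⟨A, hA, hf⟩ := hf.exists_term
    obtain ⟨B, hB, hg⟩ := hg.exists_term
    refine ⟨A ∪ B, ∅, hA.union hB, Set.countable_empty, Set.empty_subset _, fun k e X h _ => ?_⟩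
    obtain ⟨s, hs⟩ := hf k e (Set.subset_union_left.trans h)
    obtain ⟨t, ht⟩ := hg k e (Set.subset_union_right.trans h)
    first
      | exact ⟨.eq s t, fun w hw => iff_of_eq (congrArg₂ (· = ·) (hs w hw) (ht w hw))⟩
      | exact ⟨.lt s t, fun w hw => iff_of_eq (congrArg₂ (· < ·) (hs w hw) (ht w hw))⟩
  | mem f Y hf hYM =>
    obtain ⟨A, hA, hf⟩ := hf.exists_term
    refine ⟨A, {Y}, hA, Set.countable_singleton Y, Set.singleton_subset_iff.2 hYM,
      fun k e X h hY => ?_⟩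
    obtain ⟨t, ht⟩ := hf k e h
    obtain ⟨i, rfl⟩ := hY rfl
    exact ⟨.mem t i, fun w hw => by simp only [Sat, ht w hw]⟩
  | not P _ ih =>
    obtain ⟨A, B, hA, hB, hBM, h⟩ := ih
    refine ⟨A, B, hA, hB, hBM, fun k e X he hX => ?_⟩
    obtain ⟨φ, hφ⟩ := h k e X he hX
    exact ⟨.neg φ, fun w hw => by simp only [Sat, hφ w hw]⟩
  | and P Q _ _ ihP ihQ =>
    obtain ⟨A, B, hA, hB, hBM, hP⟩ := ihP
    obtain ⟨A', B', hA', hB', hBM', hQ⟩ := ihQ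
    refine ⟨A ∪ A', B ∪ B', hA.union hA', hB.union hB', Set.union_subset hBM hBM',
      fun k e X he hX => ?_⟩
    obtain ⟨heA, heA'⟩ := Set.union_subset_iff.1 he
    obtain ⟨hXB, hXB'⟩ := Set.union_subset_iff.1 hX
    obtain ⟨φ, hφ⟩ := hP k e X heA hXB
    obtain ⟨ψ, hψ⟩ := hQ k e X heA' hXB'
    exact ⟨.and φ ψ, fun w hw => by simp only [Sat, hφ w hw, hψ w hw]⟩
  | ball f P hf _ ih =>
    obtain ⟨A, hA, hf⟩ := hf.exists_term
    obtain ⟨A', B, hA', hB, hBM, hP⟩ := ih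
    refine ⟨A ∪ A', B, hA.union hA', hB, hBM, fun k e X he hX => ?_⟩
    obtain ⟨heA, heA'⟩ := Set.union_subset_iff.1 he
    obtain ⟨t, ht⟩ := hf k e heA
    obtain ⟨φ, hφ⟩ := hP (k + 1) e X heA' hX
    refine ⟨.ball t φ, fun w hw => ?_⟩
    simp only [Sat, ht w hw]
    exact forall₂_congr fun a _ => hφ (push a w) hw

theorem exists_formulas {P Q : (ℕ → M.Num) → Prop} (hP : BddPred P) (hQ : BddPred Q) :
    ∃ (φ ψ : BddFormula) (X : ℕ → Set M.Num) (e : ℕ → M.Num), (∀ i, X i ∈ M.sets) ∧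
      ∀ m n, (Sat X φ (push m (push n e)) ↔ P (push m (push n e))) ∧
        (Sat X ψ (push m (push n e)) ↔ Q (push m (push n e))) := by
  obtain ⟨A, B, hA, hB, hBM, hφ⟩ := hP.exists_formula
  obtain ⟨A', B', hA', hB', hBM', hψ⟩ := hQ.exists_formula
  obtain ⟨Z, hZ⟩ := M.sets_nonempty
  obtain ⟨e, he⟩ := ((hA.union hA').insert 0).exists_eq_range (Set.insert_nonempty _ _)
  obtain ⟨X, hX⟩ := ((hB.union hB').insert Z).exists_eq_range (Set.insert_nonempty _ _)
  obtain ⟨heA, heA'⟩ := Set.union_subset_iff.1 ((Set.subset_insert _ _).trans he.subset)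
  obtain ⟨hXB, hXB'⟩ := Set.union_subset_iff.1 ((Set.subset_insert _ _).trans hX.subset)
  obtain ⟨φ, hφ⟩ := hφ 2 e X heA hXB
  obtain ⟨ψ, hψ⟩ := hψ 2 e X heA' hXB'
  refine ⟨φ, ψ, X, e, fun i => ?_, fun m n => ⟨hφ _ fun _ => rfl, hψ _ fun _ => rfl⟩⟩
  exact Set.insert_subset hZ (Set.union_subset hBM hBM') (hX ▸ Set.mem_range_self i)

end BddPred

theorem BddTerm.subst {f : (ℕ → M.Num) → M.Num} (hf : BddTerm f)
    (F : ℕ → (ℕ → M.Num) → M.Num) (hF : ∀ i, BddTerm (F i)) :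
    BddTerm fun e => f fun i => F i e := by
  induction hf with
  | const c => exact .const c
  | var i => exact hF i
  | add f g _ _ ihf ihg => exact .add _ _ ihf ihg
  | mul f g _ _ ihf ihg => exact .mul _ _ ihf ihg

namespace BddPred

theorem subst {P : (ℕ → M.Num) → Prop} (hP : BddPred P)
    (F : ℕ → (ℕ → M.Num) → M.Num) (hF : ∀ i, BddTerm (F i)) :
    BddPred fun e => P fun i => F i e := by
  induction hP generalizing F with
  | eq f g hf hg => exact .eq _ _ (hf.subst F hF) (hg.subst F hF)
  | lt f g hf hg => exact .lt _ _ (hf.subst F hF) (hg.subst F hF)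
  | mem f Y hf hY => exact .mem _ Y (hf.subst F hF) hY
  | not P _ ih => exact .not _ (ih F hF)
  | and P Q _ _ ihP ihQ => exact .and _ _ (ihP F hF) (ihQ F hF)
  | ball f P hf _ ih =>
    let G : ℕ → (ℕ → M.Num) → M.Num
      | 0 => fun e => e 0
      | i + 1 => fun e => F i fun j => e (j + 1)
    have hG : ∀ i, BddTerm (G i)
      | 0 => .var 0
      | i + 1 => (hF i).subst (fun j e => e (j + 1)) fun _ => .var _
    exact .ball _ (fun e => P fun i => F i e) (hf.subst F hF) (ih G hG)

theorem subst₁ {P : M.Num → Prop} (hP : BddPred fun e : ℕ → M.Num => P (e 0))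
    (f : (ℕ → M.Num) → M.Num) [hf : BddTerm f] : BddPred fun e => P (f e) :=
  hP.subst (fun _ => f) fun _ => hf

theorem subst₂ {P : M.Num → M.Num → Prop} (hP : BddPred fun e : ℕ → M.Num => P (e 0) (e 1))
    (f g : (ℕ → M.Num) → M.Num) [hf : BddTerm f] [hg : BddTerm g] :
    BddPred fun e => P (f e) (g e) :=
  hP.subst (fun | 0 => f | _ => g) fun | 0 => hf | _ + 1 => hg

theorem subst₃ {P : M.Num → M.Num → M.Num → Prop}
    (hP : BddPred fun e : ℕ → M.Num => P (e 0) (e 1) (e 2))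
    (f g h : (ℕ → M.Num) → M.Num) [hf : BddTerm f] [hg : BddTerm g] [hh : BddTerm h] :
    BddPred fun e => P (f e) (g e) (h e) :=
  hP.subst (fun | 0 => f | 1 => g | _ => h) fun | 0 => hf | 1 => hg | _ + 2 => hh

theorem congr {P Q : (ℕ → M.Num) → Prop} [hP : BddPred P] (h : ∀ e, Q e ↔ P e) : BddPred Q := by
  rwa [show Q = P from funext fun e => propext (h e)]

instance (P Q : (ℕ → M.Num) → Prop) [BddPred P] [BddPred Q] : BddPred fun e => P e ∨ Q e :=
  .congr (P := fun e => ¬ (¬ P e ∧ ¬ Q e)) fun e => by tauto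

instance (P Q : (ℕ → M.Num) → Prop) [BddPred P] [BddPred Q] : BddPred fun e => P e → Q e :=
  .congr (P := fun e => ¬ (P e ∧ ¬ Q e)) fun e => by tauto

instance (P Q : (ℕ → M.Num) → Prop) [BddPred P] [BddPred Q] : BddPred fun e => P e ↔ Q e :=
  .congr (P := fun e => (P e → Q e) ∧ (Q e → P e)) fun e => by tauto

instance (f : (ℕ → M.Num) → M.Num) (P : (ℕ → M.Num) → M.Num → Prop) [BddTerm f]
    [BddPred fun e => P (fun i => e (i + 1)) (e 0)] : BddPred fun e => ∃ a, a < f e ∧ P e a :=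
  .congr (P := fun e => ¬ ∀ a, a < f e → ¬ P e a) fun e => by push Not; rfl

instance (p : Prop) : BddPred fun _ : ℕ → M.Num => p := by
  by_cases hp : p
  · exact .congr (P := fun e => e 0 = e 0) fun e => by simp [hp]
  · exact .congr (P := fun e => ¬ e 0 = e 0) fun e => by simp [hp]

instance {k : ℕ} (P : Fin k → (ℕ → M.Num) → Prop) [hP : ∀ j, BddPred (P j)] :
    BddPred fun e => ∃ j, P j e := by
  induction k with
  | zero => exact .congr (P := fun _ => False) fun e => by simp
  | succ k ih =>
    have := ih fun j => P j.succ
    exact .congr (P := fun e => P 0 e ∨ ∃ j : Fin k, P j.succ e) fun e => Fin.exists_fin_succ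

end BddPred

end

variable {M : L2Structure.{u}} [hM : Fact M.IsModelRCA₀]

/-! ### Induction and comprehension -/

theorem sigma_ind (Q : M.Num → M.Num → Prop) [hQ : BddPred fun e : ℕ → M.Num => Q (e 0) (e 1)]
    (h₀ : ∃ m, Q m 0) (h₁ : ∀ n, (∃ m, Q m n) → ∃ m, Q m (n + 1)) (n : M.Num) : ∃ m, Q m n := by
  obtain ⟨φ, _, X, e, hX, h⟩ := hQ.exists_formulas hQ
  have hφ : ∀ m n, Sat X φ (push m (push n e)) ↔ Q m n := fun m n => (h m n).1
  have := hM.out.sigma_induction φ X e hX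
  simp only [hφ] at this
  exact this h₀ h₁ n

theorem bdd_ind (P : M.Num → Prop) [hP : BddPred fun e : ℕ → M.Num => P (e 0)]
    (h₀ : P 0) (h₁ : ∀ n, P n → P (n + 1)) (n : M.Num) : P n := by
  have := hP.subst₁ (P := P) (f := fun e => e 1)
  obtain ⟨_, h⟩ := sigma_ind (fun _ n => P n) ⟨0, h₀⟩ (fun n ⟨_, h⟩ => ⟨0, h₁ n h⟩) n
  exact h

theorem setOf_exists_mem (Q Q' : M.Num → M.Num → Prop)
    [hQ : BddPred fun e : ℕ → M.Num => Q (e 0) (e 1)]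
    [hQ' : BddPred fun e : ℕ → M.Num => Q' (e 0) (e 1)]
    (h : ∀ n, (∃ m, Q m n) ↔ ∀ m, Q' m n) : {n | ∃ m, Q m n} ∈ M.sets := by
  obtain ⟨φ, ψ, X, e, hX, hφ⟩ := hQ.exists_formulas hQ'
  have h₁ : ∀ m n, Sat X φ (push m (push n e)) ↔ Q m n := fun m n => (hφ m n).1
  have h₂ : ∀ m n, Sat X ψ (push m (push n e)) ↔ Q' m n := fun m n => (hφ m n).2
  have := hM.out.delta_comprehension φ ψ X e hX
  simp only [h₁, h₂] at this
  exact this h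

theorem setOf_mem (P : M.Num → Prop) [hP : BddPred fun e : ℕ → M.Num => P (e 0)] :
    {n | P n} ∈ M.sets := by
  have := hP.subst₁ (P := P) (f := fun e => e 1)
  have h := setOf_exists_mem (fun _ n => P n) (fun _ n => P n) fun n =>
    ⟨fun ⟨_, h⟩ _ => h, fun h => ⟨0, h 0⟩⟩
  simpa using h

/-! ### The ordered semiring of numbers -/

namespace Num

protected theorem zero_add (n : M.Num) : 0 + n = n := by
  refine bdd_ind (fun n => 0 + n = n) (hM.out.add_zero 0) (fun n h => ?_) n
  rw [hM.out.add_succ, h]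

protected theorem succ_add (m n : M.Num) : m + 1 + n = m + n + 1 := by
  refine bdd_ind (fun n => m + 1 + n = m + n + 1) ?_ (fun n h => ?_) n
  · rw [hM.out.add_zero, hM.out.add_zero]
  · rw [hM.out.add_succ, h, hM.out.add_succ]

protected theorem add_comm (m n : M.Num) : m + n = n + m := by
  refine bdd_ind (fun n => m + n = n + m) ?_ (fun n h => ?_) n
  · rw [hM.out.add_zero, Num.zero_add]
  · rw [hM.out.add_succ, h, Num.succ_add]

protected theorem add_assoc (m n k : M.Num) : m + n + k = m + (n + k) := by
  refine bdd_ind (fun k => m + n + k = m + (n + k)) ?_ (fun k h => ?_) k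
  · rw [hM.out.add_zero, hM.out.add_zero]
  · rw [hM.out.add_succ, h, hM.out.add_succ, hM.out.add_succ]

protected theorem zero_mul (n : M.Num) : 0 * n = 0 := by
  refine bdd_ind (fun n => 0 * n = 0) (hM.out.mul_zero 0) (fun n h => ?_) n
  rw [hM.out.mul_succ, h, hM.out.add_zero]

protected theorem mul_add (m n k : M.Num) : m * (n + k) = m * n + m * k := by
  refine bdd_ind (fun k => m * (n + k) = m * n + m * k) ?_ (fun k h => ?_) k
  · rw [hM.out.add_zero, hM.out.mul_zero, hM.out.add_zero]
  · rw [hM.out.add_succ, hM.out.mul_succ, h, hM.out.mul_succ, Num.add_assoc]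

protected theorem succ_mul (m n : M.Num) : (m + 1) * n = m * n + n := by
  refine bdd_ind (fun n => (m + 1) * n = m * n + n) ?_ (fun n h => ?_) n
  · rw [hM.out.mul_zero, hM.out.mul_zero, hM.out.add_zero]
  · rw [hM.out.mul_succ, h, hM.out.mul_succ, Num.add_assoc, Num.add_assoc, hM.out.add_succ,
      hM.out.add_succ, hM.out.add_succ, hM.out.add_succ, Num.add_comm n m]

protected theorem mul_comm (m n : M.Num) : m * n = n * m := by
  refine bdd_ind (fun n => m * n = n * m) ?_ (fun n h => ?_) n
  · rw [hM.out.mul_zero, Num.zero_mul]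
  · rw [hM.out.mul_succ, h, Num.succ_mul]

protected theorem mul_assoc (m n k : M.Num) : m * n * k = m * (n * k) := by
  refine bdd_ind (fun k => m * n * k = m * (n * k)) ?_ (fun k h => ?_) k
  · rw [hM.out.mul_zero, hM.out.mul_zero, hM.out.mul_zero]
  · rw [hM.out.mul_succ, h, hM.out.mul_succ, Num.mul_add]

protected theorem mul_one (m : M.Num) : m * 1 = m := by
  rw [← Num.zero_add 1, hM.out.mul_succ, hM.out.mul_zero, Num.zero_add]

instance : CommSemiring M.Num where
  add_assoc := Num.add_assoc
  zero_add := Num.zero_add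
  add_zero := hM.out.add_zero
  add_comm := Num.add_comm
  left_distrib := Num.mul_add
  right_distrib a b c := by rw [Num.mul_comm, Num.mul_add, Num.mul_comm c, Num.mul_comm c]
  zero_mul := Num.zero_mul
  mul_zero := hM.out.mul_zero
  mul_assoc := Num.mul_assoc
  one_mul a := by rw [Num.mul_comm, Num.mul_one]
  mul_one := Num.mul_one
  mul_comm := Num.mul_comm
  nsmul := nsmulRec

protected theorem add_right_cancel (m n k : M.Num) : m + k = n + k → m = n := by
  refine bdd_ind (fun k => m + k = n + k → m = n) ?_ (fun k h h' => ?_) k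
  · simp
  · rw [hM.out.add_succ, hM.out.add_succ] at h'
    exact h (hM.out.succ_inj _ _ h')

theorem lt_add_succ (m k : M.Num) : m < m + (k + 1) := by
  refine bdd_ind (fun k => m < m + (k + 1)) ?_ (fun k h => ?_) k
  · rw [zero_add, hM.out.lt_succ_iff]
    exact .inr rfl
  · rw [hM.out.add_succ, hM.out.lt_succ_iff]
    exact .inl h

theorem lt_iff_exists {m n : M.Num} : m < n ↔ ∃ k, m + (k + 1) = n := by
  refine ⟨fun h => ?_, fun ⟨k, hk⟩ => hk ▸ lt_add_succ m k⟩
  obtain ⟨k, hk⟩ := sigma_ind (fun k n => m < n → m + (k + 1) = n)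
    ⟨0, fun h => (hM.out.not_lt_zero _ h).elim⟩ (fun n ⟨k, hk⟩ => by
      by_cases h : m < n
      · exact ⟨k + 1, fun _ => by rw [hM.out.add_succ, hk h]⟩
      · refine ⟨0, fun h' => ?_⟩
        obtain rfl := ((hM.out.lt_succ_iff _ _).1 h').resolve_left h
        rw [zero_add]) n
  exact ⟨k, hk h⟩

protected theorem lt_irrefl (m : M.Num) : ¬ m < m := fun h => by
  obtain ⟨k, hk⟩ := lt_iff_exists.1 h
  refine hM.out.succ_ne_zero k (Num.add_right_cancel _ _ m ?_)
  rw [add_comm, hk, zero_add]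

protected theorem lt_trans {m n k : M.Num} (h₁ : m < n) (h₂ : n < k) : m < k := by
  obtain ⟨a, rfl⟩ := lt_iff_exists.1 h₁
  obtain ⟨b, rfl⟩ := lt_iff_exists.1 h₂
  exact lt_iff_exists.2 ⟨a + (b + 1), by simp only [add_comm, add_left_comm]⟩

protected theorem zero_lt_succ (m : M.Num) : 0 < m + 1 := lt_iff_exists.2 ⟨m, zero_add _⟩

protected theorem eq_zero_or_pos (m : M.Num) : m = 0 ∨ 0 < m :=
  bdd_ind (fun m => m = 0 ∨ 0 < m) (.inl rfl) (fun m _ => .inr (Num.zero_lt_succ m)) m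

protected theorem lt_trichotomy (m n : M.Num) : m < n ∨ m = n ∨ n < m := by
  refine bdd_ind (fun n => m < n ∨ m = n ∨ n < m) (.inr (Num.eq_zero_or_pos m)) (fun n h => ?_) n
  rcases h with h | rfl | h
  · exact .inl ((hM.out.lt_succ_iff _ _).2 (.inl h))
  · exact .inl ((hM.out.lt_succ_iff _ _).2 (.inr rfl))
  · obtain ⟨k, rfl⟩ := lt_iff_exists.1 h
    rcases Num.eq_zero_or_pos k with rfl | hk
    · exact .inr (.inl (by rw [zero_add]))
    · obtain ⟨j, rfl⟩ := lt_iff_exists.1 hk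
      exact .inr (.inr (lt_iff_exists.2 ⟨j, by simp only [zero_add, add_comm, add_left_comm]⟩))

noncomputable instance : LinearOrder M.Num where
  lt := (· < ·)
  le m n := m < n ∨ m = n
  le_refl m := .inr rfl
  le_trans a b c := by
    rintro (h₁ | rfl) (h₂ | rfl)
    exacts [.inl (Num.lt_trans h₁ h₂), .inl h₁, .inl h₂, .inr rfl]
  le_antisymm a b := by
    rintro (h₁ | rfl) (h₂ | h₂)
    exacts [(Num.lt_irrefl _ (Num.lt_trans h₁ h₂)).elim, h₂.symm, rfl, rfl]
  le_total a b := by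
    rcases Num.lt_trichotomy a b with h | h | h
    exacts [.inl (.inl h), .inl (.inr h), .inr (.inl h)]
  lt_iff_le_not_ge a b := by
    refine ⟨fun h => ⟨.inl h, ?_⟩, fun ⟨h₁, h₂⟩ => h₁.resolve_right fun h => h₂ (.inr h.symm)⟩
    rintro (h' | rfl)
    exacts [Num.lt_irrefl _ (Num.lt_trans h h'), Num.lt_irrefl _ h]
  toDecidableLE := Classical.decRel _

theorem le_iff_exists {m n : M.Num} : m ≤ n ↔ ∃ k, n = m + k := by
  rw [le_iff_lt_or_eq, lt_iff_exists]
  constructor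
  · rintro (⟨k, rfl⟩ | rfl)
    exacts [⟨k + 1, rfl⟩, ⟨0, (add_zero _).symm⟩]
  · rintro ⟨k, rfl⟩
    rcases Num.eq_zero_or_pos k with rfl | h
    · exact .inr (add_zero _).symm
    · obtain ⟨j, rfl⟩ := lt_iff_exists.1 h
      exact .inl ⟨j, by rw [zero_add]⟩

instance : IsOrderedCancelAddMonoid M.Num where
  add_le_add_left a b h c := by
    obtain ⟨k, rfl⟩ := le_iff_exists.1 h
    exact le_iff_exists.2 ⟨k, by rw [add_right_comm]⟩
  le_of_add_le_add_left a b c h := by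
    obtain ⟨k, hk⟩ := le_iff_exists.1 h
    refine le_iff_exists.2 ⟨k, Num.add_right_cancel _ _ a ?_⟩
    rw [add_comm, hk, add_comm a, add_right_comm]

instance : CanonicallyOrderedAdd M.Num where
  exists_add_of_le := le_iff_exists.1
  le_self_add _ b := le_iff_exists.2 ⟨b, rfl⟩
  le_add_self _ b := le_iff_exists.2 ⟨b, add_comm _ _⟩

instance : Nontrivial M.Num :=
  ⟨⟨1, 0, fun h => hM.out.succ_ne_zero 0 (by rw [zero_add, h])⟩⟩

instance : IsStrictOrderedRing M.Num where
  zero_le_one := zero_le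
  mul_lt_mul_of_pos_left a ha b c h := by
    obtain ⟨i, rfl⟩ := lt_iff_exists.1 ha
    obtain ⟨j, rfl⟩ := lt_iff_exists.1 h
    exact lt_iff_exists.2 ⟨i * j + i + j, by ring⟩
  mul_lt_mul_of_pos_right a ha b c h := by
    obtain ⟨i, rfl⟩ := lt_iff_exists.1 ha
    obtain ⟨j, rfl⟩ := lt_iff_exists.1 h
    exact lt_iff_exists.2 ⟨i * j + i + j, by ring⟩

theorem lt_add_one_iff {m n : M.Num} : m < n + 1 ↔ m ≤ n := hM.out.lt_succ_iff m n

theorem add_one_le_iff {m n : M.Num} : m + 1 ≤ n ↔ m < n := by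
  rw [← not_lt, lt_add_one_iff, not_le]

theorem le_mul_self (a : M.Num) : a ≤ a * a := by
  rcases eq_zero_or_pos a with rfl | h
  · simp
  · exact le_mul_of_one_le_left zero_le (by simpa using add_one_le_iff.2 h)

theorem add_self_inj {a b : M.Num} : a + a = b + b ↔ a = b := by
  refine ⟨fun h => ?_, fun h => by rw [h]⟩
  rcases lt_trichotomy a b with h' | rfl | h'
  exacts [absurd h (add_lt_add h' h').ne, rfl, absurd h (add_lt_add h' h').ne']

theorem add_self_ne (a b : M.Num) : a + a ≠ b + b + 1 := by
  intro h
  rcases le_or_gt a b with hab | hab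
  · exact (lt_add_one_iff.2 (add_le_add hab hab)).ne h
  · have : b + b + 1 < a + a := by
      calc b + b + 1 < b + b + 1 + 1 := lt_add_one _
        _ = (b + 1) + (b + 1) := by ring
        _ ≤ a + a := add_le_add (add_one_le_iff.2 hab) (add_one_le_iff.2 hab)
    exact this.ne' h

end Num

namespace BddPred

section

variable (f g : (ℕ → M.Num) → M.Num) (P : (ℕ → M.Num) → M.Num → Prop) [BddTerm f] [BddTerm g]
  [BddPred fun e => P (fun i => e (i + 1)) (e 0)]

instance : BddPred fun e => f e ≤ g e :=
  .congr (P := fun e => f e < g e + 1) fun _ => Num.lt_add_one_iff.symm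

instance : BddPred fun e => ∀ a, a ≤ f e → P e a :=
  .congr (P := fun e => ∀ a, a < f e + 1 → P e a) fun _ => by simp only [Num.lt_add_one_iff]

instance : BddPred fun e => ∃ a, a ≤ f e ∧ P e a :=
  .congr (P := fun e => ∃ a, a < f e + 1 ∧ P e a) fun _ => by simp only [Num.lt_add_one_iff]

end

end BddPred

theorem bdd_least (P : M.Num → Prop) [hP : BddPred fun e : ℕ → M.Num => P (e 0)] {n : M.Num}
    (hn : P n) : ∃ m, P m ∧ ∀ k, k < m → ¬ P k := by
  by_contra! h
  have (f : (ℕ → M.Num) → M.Num) [BddTerm f] := hP.subst₁ (P := P) f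
  have not_below := bdd_ind (fun m => ∀ k, k < m → ¬ P k)
    (fun k hk => absurd hk not_lt_zero) fun m hm k hk hPk => by
      obtain ⟨j, hjk, hPj⟩ := h k hPk
      exact hm j (hjk.trans_le (Num.lt_add_one_iff.1 hk)) hPj
  exact not_below (n + 1) n (lt_add_one n) hn

theorem collection (Q : M.Num → M.Num → Prop) [hQ : BddPred fun e : ℕ → M.Num => Q (e 0) (e 1)]
    (k : M.Num) (h : ∀ n < k, ∃ m, Q m n) : ∃ b, ∀ n < k, ∃ m < b, Q m n := by
  have (f g : (ℕ → M.Num) → M.Num) [BddTerm f] [BddTerm g] := hQ.subst₂ (P := Q) f g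
  obtain ⟨b, hb⟩ := sigma_ind (fun b j => j ≤ k → ∀ n < j, ∃ m < b, Q m n)
    ⟨0, fun _ n hn => absurd hn not_lt_zero⟩ (fun j ⟨b, hb⟩ => by
      by_cases hj : j < k
      · obtain ⟨m, hm⟩ := h j hj
        refine ⟨b + (m + 1), fun _ n hn => ?_⟩
        rcases (Num.lt_add_one_iff.1 hn).lt_or_eq with hn | rfl
        · obtain ⟨m', h₁, h₂⟩ := hb hj.le n hn
          exact ⟨m', h₁.trans_le le_self_add, h₂⟩
        · exact ⟨m, (lt_add_one m).trans_le le_add_self, hm⟩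
      · exact ⟨0, fun h => absurd (Num.add_one_le_iff.1 h) hj⟩) k
  exact ⟨b, hb le_rfl⟩

/-! ### Pairs and codes of finite sets -/

theorem left_le_pair (i j : M.Num) : i ≤ pair i j := le_add_self

theorem right_le_pair (i j : M.Num) : j ≤ pair i j :=
  le_add_self.trans ((Num.le_mul_self (i + j)).trans le_self_add)

theorem pair_le_pair {i j k l : M.Num} (h₁ : i ≤ k) (h₂ : j ≤ l) : pair i j ≤ pair k l := by
  unfold pair
  gcongr

theorem pair_lt_of_add_lt {i j k l : M.Num} (h : i + j < k + l) : pair i j < pair k l := by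
  have hkl : i + j + 1 ≤ k + l := Num.add_one_le_iff.2 h
  calc pair i j ≤ pair i j + (i + j + j) := le_self_add
    _ < pair i j + (i + j + j) + 1 := lt_add_one _
    _ = (i + j + 1) * (i + j + 1) := by unfold pair; ring
    _ ≤ (k + l) * (k + l) := by gcongr
    _ ≤ pair k l := le_self_add

theorem pair_inj {i j k l : M.Num} : pair i j = pair k l ↔ i = k ∧ j = l := by
  refine ⟨fun h => ?_, fun ⟨h₁, h₂⟩ => h₁ ▸ h₂ ▸ rfl⟩
  rcases lt_trichotomy (i + j) (k + l) with h' | h' | h'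
  · exact absurd h (pair_lt_of_add_lt h').ne
  · unfold pair at h
    rw [h'] at h
    obtain rfl := add_left_cancel h
    exact ⟨rfl, add_left_cancel h'⟩
  · exact absurd h (pair_lt_of_add_lt h').ne'

theorem exists_pair_eq_iff {i j : M.Num} {P : M.Num → M.Num → Prop} :
    (∃ k l, pair i j = pair k l ∧ P k l) ↔ P i j := by
  simp [pair_inj]

instance BddTerm.pair (f g : (ℕ → M.Num) → M.Num) [BddTerm f] [BddTerm g] :
    BddTerm fun e => pair (f e) (g e) :=
  inferInstanceAs (BddTerm fun e => (f e + g e) * (f e + g e) + f e)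

theorem Num.dvd_iff_exists_le {a b : M.Num} : a ∣ b ↔ ∃ q ≤ b, b = a * q := by
  refine ⟨fun ⟨q, hq⟩ => ?_, fun ⟨q, _, hq⟩ => ⟨q, hq⟩⟩
  rcases eq_zero_or_pos a with rfl | h
  · exact ⟨0, zero_le, by simpa using hq⟩
  · refine ⟨q, ?_, hq⟩
    rw [hq]
    exact le_mul_of_one_le_left zero_le (by simpa using Num.add_one_le_iff.2 h)

instance (f g : (ℕ → M.Num) → M.Num) [BddTerm f] [BddTerm g] : BddPred fun e => f e ∣ g e :=
  have : BddPred fun e : ℕ → M.Num => e 0 ∣ e 1 := .congr fun _ => Num.dvd_iff_exists_le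
  this.subst₂ (P := (· ∣ ·)) f g

theorem inCode_pair {i k m n : M.Num} :
    InCode i (pair k (pair m n)) ↔ i < k ∧ m * (i + 1) + 1 ∣ n := by
  constructor
  · rintro ⟨k', m', n', h, hi, q, hq⟩
    simp only [pair_inj] at h
    obtain ⟨rfl, rfl, rfl⟩ := h
    exact ⟨hi, q, by rw [hq, mul_comm]⟩
  · rintro ⟨hi, q, hq⟩
    exact ⟨k, m, n, rfl, hi, q, by rw [hq, mul_comm]⟩

theorem inCode_iff_exists_le {i c : M.Num} : InCode i c ↔
    ∃ k ≤ c, ∃ m ≤ c, ∃ n ≤ c, c = pair k (pair m n) ∧ i < k ∧ m * (i + 1) + 1 ∣ n := by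
  constructor
  · rintro ⟨k, m, n, rfl, h⟩
    exact ⟨k, left_le_pair _ _, m, (left_le_pair m n).trans (right_le_pair _ _), n,
      (right_le_pair m n).trans (right_le_pair _ _), rfl, inCode_pair.1 ⟨k, m, n, rfl, h⟩⟩
  · rintro ⟨k, -, m, -, n, -, rfl, h⟩
    exact inCode_pair.2 h

theorem InCode.lt {i c : M.Num} (h : InCode i c) : i < c := by
  obtain ⟨k, m, n, rfl, hi, -⟩ := h
  exact hi.trans_le (left_le_pair _ _)

instance (f g : (ℕ → M.Num) → M.Num) [BddTerm f] [BddTerm g] :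
    BddPred fun e => InCode (f e) (g e) :=
  have : BddPred fun e : ℕ → M.Num => InCode (e 0) (e 1) := .congr fun _ => inCode_iff_exists_le
  this.subst₂ (P := InCode) f g

section

variable (f : (ℕ → M.Num) → M.Num) (P : (ℕ → M.Num) → M.Num → Prop) [hf : BddTerm f]
  [BddPred fun e => P (fun i => e (i + 1)) (e 0)]

instance : BddPred fun e => ∀ i, InCode i (f e) → P e i :=
  have : BddTerm fun e => f fun i => e (i + 1) := hf.subst (fun i e => e (i + 1)) fun _ => .var _
  .congr (P := fun e => ∀ i, i < f e → InCode i (f e) → P e i) fun _ =>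
    forall_congr' fun _ => ⟨fun h _ => h, fun h hi => h hi.lt hi⟩

instance : BddPred fun e => ∃ i, InCode i (f e) ∧ P e i :=
  have : BddTerm fun e => f fun i => e (i + 1) := hf.subst (fun i e => e (i + 1)) fun _ => .var _
  .congr (P := fun e => ∃ i, i < f e ∧ InCode i (f e) ∧ P e i) fun _ =>
    exists_congr fun _ => ⟨fun h => ⟨h.1.lt, h⟩, And.right⟩

end

theorem isFinCode_iff {c : M.Num} :
    IsFinCode c ↔ ∀ d < c, ∃ i < c, ¬ (InCode i d ↔ InCode i c) := by
  refine forall₂_congr fun d hd => ⟨fun ⟨i, hi⟩ => ⟨i, ?_, hi⟩, fun ⟨i, _, hi⟩ => ⟨i, hi⟩⟩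
  by_contra hic
  exact hi ⟨fun h => absurd (h.lt.trans hd) hic, fun h => absurd h.lt hic⟩

instance (f : (ℕ → M.Num) → M.Num) [BddTerm f] : BddPred fun e => IsFinCode (f e) :=
  have : BddPred fun e : ℕ → M.Num => IsFinCode (e 0) := .congr fun _ => isFinCode_iff
  this.subst₁ (P := IsFinCode) f

/-- Gödel's β-function: each subset of `{0, …, b - 1}` is coded by `(b, (m, n))` for some `n ≤ p`,
since the moduli `m (i + 1) + 1` with `i < b` are pairwise coprime. -/
def CodeBound (b m p : M.Num) : Prop :=
  0 < m ∧ 0 < p ∧ ∀ i < b, i + 1 ∣ m ∧ m * (i + 1) + 1 ∣ p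

theorem exists_forall_lt_dvd (F : M.Num → M.Num) [hF : BddTerm fun e : ℕ → M.Num => F (e 0)]
    (hpos : ∀ i, 0 < F i) (b : M.Num) : ∃ p, 0 < p ∧ ∀ i < b, F i ∣ p := by
  have (f : (ℕ → M.Num) → M.Num) [hf : BddTerm f] : BddTerm fun e => F (f e) :=
    hF.subst (fun _ => f) fun _ => hf
  refine sigma_ind (fun p b => 0 < p ∧ ∀ i < b, F i ∣ p)
    ⟨1, zero_lt_one, fun i hi => absurd hi not_lt_zero⟩ (fun b ⟨p, hp, h⟩ => ?_) b
  refine ⟨p * F b, mul_pos hp (hpos b), fun i hi => ?_⟩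
  rcases (Num.lt_add_one_iff.1 hi).lt_or_eq with hi | rfl
  · exact (h i hi).mul_right _
  · exact dvd_mul_left _ _

theorem exists_codeBound (b : M.Num) : ∃ m p, CodeBound b m p := by
  obtain ⟨m, hm, hm'⟩ := exists_forall_lt_dvd (fun i => i + (1 : M.Num)) (fun i => by positivity) b
  obtain ⟨p, hp, hp'⟩ :=
    exists_forall_lt_dvd (fun i => m * (i + 1) + 1) (fun i => by positivity) b
  exact ⟨m, p, hm, hp, fun i hi => ⟨hm' i hi, hp' i hi⟩⟩

theorem Num.dvd_of_dvd_add {a b c : M.Num} (h : a ∣ b + c) (h' : a ∣ b) : a ∣ c := by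
  obtain ⟨x, rfl⟩ := h'
  obtain ⟨y, hy⟩ := h
  rcases eq_zero_or_pos a with rfl | ha
  · simp only [zero_mul, zero_add] at hy
    simp [hy]
  · have : x ≤ y := le_of_mul_le_mul_left (hy ▸ le_self_add) ha
    obtain ⟨z, rfl⟩ := exists_add_of_le this
    exact ⟨z, add_left_cancel (a := a * x) (by rw [hy, mul_add])⟩

theorem dvd_of_dvd_modulus_mul {i j d m n : M.Num} (hd : d ∣ m) (hij : i = j + d ∨ j = i + d)
    (h : m * (i + 1) + 1 ∣ (m * (j + 1) + 1) * n) : m * (i + 1) + 1 ∣ n := by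
  obtain ⟨t, rfl⟩ := hd
  -- The moduli `x = m (i + 1) + 1` and `y = m (j + 1) + 1` are coprime because
  -- `(i + 1) y - (j + 1) x = ± d` and `x`, `y` are coprime to `m`, hence to `d`. The summand `b`
  -- below is what remains of the Bézout identity for `n` when no term may be subtracted.
  rcases hij with rfl | rfl
  · refine Num.dvd_of_dvd_add
      (b := (j + d + 1) * (j + d + 1) * t * ((d * t * (j + 1) + 1) * n)) ?_ (h.mul_left _)
    exact ⟨n + (j + d + 1) * t * (j + 1) * n, by ring⟩
  · refine Num.dvd_of_dvd_add
      (b := (d * t * (i + 1) + 1) * ((i + 1) * t * (i + d + 1) * n)) ?_ (dvd_mul_right _ _)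
    have : (d * t * (i + 1) + 1) * ((i + 1) * t * (i + d + 1) * n) + n =
        (d * t * (i + 1) + 1) * n + (i + 1) * (i + 1) * t * ((d * t * (i + d + 1) + 1) * n) := by
      ring
    rw [this]
    exact (dvd_mul_right _ _).add (h.mul_left _)

theorem CodeBound.dvd_of_ne {b m p i j n : M.Num} (h : CodeBound b m p) (hi : i < b) (hj : j < b)
    (hij : i ≠ j) (hn : m * (i + 1) + 1 ∣ (m * (j + 1) + 1) * n) : m * (i + 1) + 1 ∣ n := by
  obtain ⟨-, -, h⟩ := h
  rcases hij.lt_or_gt with hij | hij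
  · obtain ⟨d, rfl⟩ := Num.lt_iff_exists.1 hij
    have hd : d < b := (Num.add_one_le_iff.1 le_add_self).trans hj
    exact dvd_of_dvd_modulus_mul (h d hd).1 (.inr rfl) hn
  · obtain ⟨d, rfl⟩ := Num.lt_iff_exists.1 hij
    have hd : d < b := (Num.add_one_le_iff.1 le_add_self).trans hi
    exact dvd_of_dvd_modulus_mul (h d hd).1 (.inl rfl) hn

theorem CodeBound.exists_code {b m p : M.Num} (h : CodeBound b m p) {X : Set M.Num}
    (hX : X ∈ M.sets) : ∃ n ≤ p, ∀ i, InCode i (pair b (pair m n)) ↔ i < b ∧ i ∈ X := by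
  have := Fact.mk hX
  have hp : 0 < p ∧ ∀ i < b, i ∈ X → m * (i + 1) + 1 ∣ p := ⟨h.2.1, fun i hi _ => (h.2.2 i hi).2⟩
  obtain ⟨n, ⟨hn, hnX⟩, hmin⟩ :=
    bdd_least (fun n => 0 < n ∧ ∀ i < b, i ∈ X → m * (i + 1) + 1 ∣ n) hp
  refine ⟨n, le_of_not_gt fun hlt => hmin p hlt hp, fun j => ?_⟩
  rw [inCode_pair]
  refine and_congr_right fun hj => ⟨fun hjn => ?_, fun hjX => hnX j hj hjX⟩
  by_contra hjX
  obtain ⟨q, rfl⟩ := hjn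
  have hq : 0 < q := pos_of_mul_pos_right hn zero_le
  have hm : 0 < m * (j + 1) := mul_pos h.1 (by positivity)
  refine hmin q ((lt_mul_iff_one_lt_left hq).2 (lt_add_of_pos_left 1 hm)) ⟨hq, fun i hi hiX => ?_⟩
  exact h.dvd_of_ne hi hj (fun hij => hjX (hij ▸ hiX)) (hnX i hi hiX)

theorem exists_finCode {X : Set M.Num} (hX : X ∈ M.sets) {b : M.Num} (hb : ∀ i ∈ X, i < b) :
    ∃ c, IsFinCode c ∧ ∀ i, InCode i c ↔ i ∈ X := by
  have := Fact.mk hX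
  obtain ⟨m, p, h⟩ := exists_codeBound b
  obtain ⟨n, -, hn⟩ := h.exists_code hX
  have codes_iff (c : M.Num) : (∀ i, InCode i c ↔ i ∈ X) ↔
      (∀ i < c, InCode i c → i ∈ X) ∧ ∀ i < b, i ∈ X → InCode i c :=
    ⟨fun h => ⟨fun i _ => (h i).1, fun i _ => (h i).2⟩,
      fun h i => ⟨fun hi => h.1 i hi.lt hi, fun hi => h.2 i (hb i hi) hi⟩⟩
  obtain ⟨c, hc, hmin⟩ :=
    bdd_least (fun c => (∀ i < c, InCode i c → i ∈ X) ∧ ∀ i < b, i ∈ X → InCode i c)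
      ((codes_iff _).1 fun i => (hn i).trans ⟨And.right, fun hi => ⟨hb i hi, hi⟩⟩)
  rw [← codes_iff] at hc
  refine ⟨c, fun d hd => ?_, hc⟩
  by_contra! h'
  exact hmin d hd ((codes_iff d).1 fun i => (h' i).trans (hc i))

theorem IsFinCode.eq {c d : M.Num} (hc : IsFinCode c) (hd : IsFinCode d)
    (h : ∀ i, InCode i c ↔ InCode i d) : c = d := by
  rcases lt_trichotomy c d with hlt | rfl | hlt
  · obtain ⟨i, hi⟩ := hd c hlt
    exact absurd (h i) hi
  · rfl
  · obtain ⟨i, hi⟩ := hc d hlt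
    exact absurd (h i).symm hi

/-- The finite set coded by `c`. -/
def codeSet (c : M.Num) : Set M.Num := {i | InCode i c}

theorem codeSet_mem_sets (c : M.Num) : codeSet c ∈ M.sets := setOf_mem (InCode · c)

theorem exists_vec (n : M.Num) {X : Set M.Num} (hX : X ∈ M.sets) :
    ∃ a, IsVec n a ∧ ∀ i, InCode i a ↔ i < n ∧ i ∈ X := by
  have := Fact.mk hX
  obtain ⟨a, ha, h⟩ := exists_finCode (setOf_mem fun i => i < n ∧ i ∈ X) (b := n) fun i hi => hi.1
  exact ⟨a, ⟨ha, fun i hi => ((h i).1 hi).1⟩, h⟩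

theorem IsVec.eq {n a b : M.Num} (ha : IsVec n a) (hb : IsVec n b)
    (h : ∀ i < n, (InCode i a ↔ InCode i b)) : a = b :=
  ha.1.eq hb.1 fun i => ⟨fun hi => (h i (ha.2 i hi)).1 hi, fun hi => (h i (hb.2 i hi)).2 hi⟩

/-! ### Unbounded `Σ⁰₁` classes -/

/-- The enumeration of the class `{x | ∃ w, Q w x}` in which the pair `(x, w)` with `Q w x`
contributes `x` at stage `pair x w`. -/
def EnumeratedAt (Q : M.Num → M.Num → Prop) (t x : M.Num) : Prop := ∃ w ≤ t, t = pair x w ∧ Q w x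

/-- The number `x`, enumerated at stage `t`, exceeds everything enumerated before. -/
def IsRecordAt (Q : M.Num → M.Num → Prop) (t x : M.Num) : Prop :=
  EnumeratedAt Q t x ∧ ∀ t' < t, ∀ x' ≤ t', EnumeratedAt Q t' x' → x' < x

section

variable {Q : M.Num → M.Num → Prop}

theorem enumeratedAt_pair {x w : M.Num} (h : Q w x) :
    EnumeratedAt Q (pair x w) x := ⟨w, right_le_pair x w, rfl, h⟩

theorem EnumeratedAt.le {t x : M.Num} (h : EnumeratedAt Q t x) : x ≤ t := by
  obtain ⟨w, -, rfl, -⟩ := h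
  exact left_le_pair x w

variable [hQ : BddPred fun e : ℕ → M.Num => Q (e 0) (e 1)] (f g : (ℕ → M.Num) → M.Num)
  [BddTerm f] [BddTerm g]

instance : BddPred fun e => EnumeratedAt Q (f e) (g e) :=
  have (f g : (ℕ → M.Num) → M.Num) [BddTerm f] [BddTerm g] := hQ.subst₂ (P := Q) f g
  have : BddPred fun e : ℕ → M.Num => EnumeratedAt Q (e 0) (e 1) := by
    unfold EnumeratedAt
    infer_instance
  this.subst₂ (P := EnumeratedAt Q) f g

instance : BddPred fun e => IsRecordAt Q (f e) (g e) :=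
  have : BddPred fun e : ℕ → M.Num => IsRecordAt Q (e 0) (e 1) := by
    unfold IsRecordAt
    infer_instance
  this.subst₂ (P := IsRecordAt Q) f g

end

theorem exists_infinite_subset (Q : M.Num → M.Num → Prop)
    [hQ : BddPred fun e : ℕ → M.Num => Q (e 0) (e 1)] (h : ∀ b, ∃ x, b < x ∧ ∃ w, Q w x) :
    ∃ H ∈ M.sets, IsInf H ∧ ∀ x ∈ H, ∃ w, Q w x := by
  have enumerated_above (b : M.Num) : ∃ t x, EnumeratedAt Q t x ∧ b < x := by
    obtain ⟨x, hbx, w, hw⟩ := h b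
    exact ⟨_, x, enumeratedAt_pair hw, hbx⟩
  refine ⟨{x | ∃ t, IsRecordAt Q t x}, ?_, fun b => ?_, ?_⟩
  · -- `x` is a record iff it has become one by any stage that enumerates a larger number.
    refine setOf_exists_mem (IsRecordAt Q) (fun t x =>
      (∃ x' ≤ t, EnumeratedAt Q t x' ∧ x < x') → ∃ t' ≤ t, IsRecordAt Q t' x)
      fun x => ⟨?_, fun hx => ?_⟩
    · rintro ⟨s, hs⟩ t ⟨x', hx't, hx', hlt⟩
      exact ⟨s, le_of_not_gt fun hts => lt_asymm hlt (hs.2 t hts x' hx't hx'), hs⟩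
    · obtain ⟨t, x', hx', hlt⟩ := enumerated_above x
      obtain ⟨s, -, hs⟩ := hx t ⟨x', hx'.le, hx', hlt⟩
      exact ⟨s, hs⟩
  · obtain ⟨t₀, x₀, hx₀, hlt⟩ := enumerated_above b
    obtain ⟨t, ⟨x, -, hx, hbx⟩, hmin⟩ :=
      bdd_least (fun t => ∃ x ≤ t, EnumeratedAt Q t x ∧ b < x) ⟨x₀, hx₀.le, hx₀, hlt⟩
    refine ⟨x, ⟨t, hx, fun t' ht' x' hx't hx' => ?_⟩, hbx⟩
    by_contra hxx'
    exact hmin t' ht' ⟨x', hx't, hx', hbx.trans_le (not_lt.1 hxx')⟩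
  · rintro x ⟨t, ⟨w, -, -, hw⟩, -⟩
    exact ⟨w, hw⟩

/-! ### Assignments -/

theorem empty_mem_sets : (∅ : Set M.Num) ∈ M.sets := setOf_mem fun _ => False

theorem univ_mem_sets : (Set.univ : Set M.Num) ∈ M.sets := setOf_mem fun _ => True

theorem satisfies_pair {ν : Set M.Num} {n r s : M.Num} : Satisfies ν (pair (pair n r) s) ↔
    ∃ a, InCode a r ∧ ∀ i y, InCode (pair i y) s → (InCode i a ↔ y ∈ ν) := by
  simp [Satisfies, pair_inj, and_assoc]

theorem isRel_pair {n r : M.Num} :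
    IsRel (pair n r) ↔ IsFinCode r ∧ ∀ a, InCode a r → IsVec n a := exists_pair_eq_iff

theorem IsSeq.lt_of_inCode {n s i y : M.Num} (hs : IsSeq n s) (h : InCode (pair i y) s) :
    i < n := by
  obtain ⟨j, z, hj, hp⟩ := hs.2.1 _ h
  exact (pair_inj.1 hp).1 ▸ hj

theorem lt_of_inCode_pair {ρ i y s : M.Num} (h : InCode (pair i y) s) : y < pair ρ s :=
  ((right_le_pair i y).trans_lt h.lt).trans_le (right_le_pair _ _)

theorem Satisfies.congr {ν ν' : Set M.Num} {φ : M.Num} (h : Satisfies ν φ)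
    (hν : ∀ y < φ, (y ∈ ν ↔ y ∈ ν')) : Satisfies ν' φ := by
  obtain ⟨n, r, s, rfl, a, ha, has⟩ := h
  exact ⟨n, r, s, rfl, a, ha, fun i y hy => (has i y hy).trans (hν y (lt_of_inCode_pair hy))⟩

theorem IsSeq.exists_vec {n s : M.Num} (hs : IsSeq n s) {ν : Set M.Num} (hν : ν ∈ M.sets) :
    ∃ a, IsVec n a ∧ ∀ i y, InCode (pair i y) s → (InCode i a ↔ y ∈ ν) := by
  have := Fact.mk hν
  obtain ⟨a, ha, h⟩ := L2Structure.exists_vec n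
    (setOf_mem fun i => ∃ y < s, InCode (pair i y) s ∧ y ∈ ν)
  refine ⟨a, ha, fun i y hy => (h i).trans ⟨?_, fun hyν => ?_⟩⟩
  · rintro ⟨hi, z, -, hz, hzν⟩
    rwa [(hs.2.2 i hi).unique hy hz]
  · exact ⟨hs.lt_of_inCode hy, y, (right_le_pair i y).trans_lt hy.lt, hy, hyν⟩

theorem satisfies_iff_inCode {n r s a : M.Num} {ν : Set M.Num} (hr : IsRel (pair n r))
    (hs : IsSeq n s) (ha : IsVec n a) (h : ∀ i y, InCode (pair i y) s → (InCode i a ↔ y ∈ ν)) :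
    Satisfies ν (pair (pair n r) s) ↔ InCode a r := by
  rw [satisfies_pair]
  refine ⟨fun ⟨b, hb, hbν⟩ => ?_, fun h' => ⟨a, h', h⟩⟩
  rwa [ha.eq ((isRel_pair.1 hr).2 b hb) fun i hi => ?_]
  obtain ⟨y, hy, -⟩ := hs.2.2 i hi
  exact (h i y hy).trans (hbν i y hy).symm

/-- The set `ν` if `p` is `true`, and its complement if `p` is `false`. Exchanging the truth values
turns horn into co-horn relations, so that both can be treated at once. -/
def polar (p : Bool) (ν : Set M.Num) : Set M.Num := {i | i ∈ ν ↔ p = true}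

omit hM in
theorem mem_polar {p : Bool} {ν : Set M.Num} {i : M.Num} : i ∈ polar p ν ↔ (i ∈ ν ↔ p = true) :=
  Iff.rfl

omit hM in
theorem polar_polar (p : Bool) (ν : Set M.Num) : polar p (polar p ν) = ν := by
  ext i
  cases p <;> simp [mem_polar]

theorem polar_mem_sets (p : Bool) {ν : Set M.Num} (hν : ν ∈ M.sets) : polar p ν ∈ M.sets := by
  have := Fact.mk hν
  exact setOf_mem fun i => i ∈ ν ↔ p = true

theorem satisfies_polar_codeSet_iff {p : Bool} {c φ : M.Num} :
    Satisfies (polar p (codeSet c)) φ ↔ ∃ n ≤ φ, ∃ r ≤ φ, ∃ s ≤ φ, φ = pair (pair n r) s ∧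
      ∃ a < r, InCode a r ∧ ∀ i < s, ∀ y < s, InCode (pair i y) s →
        (InCode i a ↔ (InCode y c ↔ p = true)) := by
  constructor
  · rintro ⟨n, r, s, rfl, a, ha, h⟩
    exact ⟨n, (left_le_pair n r).trans (left_le_pair _ _), r,
      (right_le_pair n r).trans (left_le_pair _ _), s, right_le_pair _ _, rfl, a, ha.lt, ha,
      fun i _ y _ => h i y⟩
  · rintro ⟨n, -, r, -, s, -, rfl, a, -, ha, h⟩
    exact ⟨n, r, s, rfl, a, ha, fun i y hy => h i ((left_le_pair i y).trans_lt hy.lt) y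
      ((right_le_pair i y).trans_lt hy.lt) hy⟩

instance (p : Bool) (f g : (ℕ → M.Num) → M.Num) [BddTerm f] [BddTerm g] :
    BddPred fun e => Satisfies (polar p (codeSet (f e))) (g e) :=
  have : BddPred fun e : ℕ → M.Num => Satisfies (polar p (codeSet (e 0))) (e 1) :=
    .congr fun _ => satisfies_polar_codeSet_iff
  this.subst₂ (P := fun c φ => Satisfies (polar p (codeSet c)) φ) f g

/-! ### Homogeneous sets from least models -/

/-- The assignment `polar p ν` satisfies the members of `C` below `d`. -/
def IsModelBelow (p : Bool) (C : Set M.Num) (d : M.Num) (ν : Set M.Num) : Prop :=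
  ∀ φ < d, φ ∈ C → Satisfies (polar p ν) φ

theorem IsModelBelow.mono {p : Bool} {C : Set M.Num} {d d' : M.Num}
    {ν : Set M.Num} (h : IsModelBelow p C d ν) (hd : d' ≤ d) : IsModelBelow p C d' ν :=
  fun φ hφ => h φ (hφ.trans_le hd)

theorem IsModelBelow.congr {p : Bool} {C : Set M.Num} {d : M.Num} {ν ν' : Set M.Num}
    (h : IsModelBelow p C d ν) (hν : ∀ y < d, (y ∈ ν ↔ y ∈ ν')) : IsModelBelow p C d ν' :=
  fun φ hφ hC => (h φ hφ hC).congr fun y hy => by simp only [mem_polar, hν y (hy.trans hφ)]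

instance (p : Bool) (C : Set M.Num) [Fact (C ∈ M.sets)]
    (f g : (ℕ → M.Num) → M.Num) [BddTerm f] [BddTerm g] :
    BddPred fun e => IsModelBelow p C (f e) (codeSet (g e)) :=
  have : BddPred fun e : ℕ → M.Num => IsModelBelow p C (e 0) (codeSet (e 1)) := by
    unfold IsModelBelow
    infer_instance
  this.subst₂ (P := fun d c => IsModelBelow p C d (codeSet c)) f g

theorem FinSatisfiable.exists_isModelBelow {C : Set M.Num} (hC : C ∈ M.sets)
    (h : FinSatisfiable C) (p : Bool) (d : M.Num) : ∃ ν ∈ M.sets, IsModelBelow p C d ν := by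
  have := Fact.mk hC
  obtain ⟨ν, hν, h'⟩ := h {φ | φ ∈ C ∧ φ < d}
    ⟨setOf_mem fun φ => φ ∈ C ∧ φ < d, d, fun φ hφ => hφ.2⟩ fun φ hφ => hφ.1
  exact ⟨polar p ν, polar_mem_sets p hν, fun φ hφd hφC => by
    simpa only [polar_polar] using h' φ ⟨hφC, hφd⟩⟩

/-- The element `x` belongs to every model of the members of `C` below `d`. -/
def IsForced (p : Bool) (C : Set M.Num) (d x : M.Num) : Prop :=
  ∀ ν ∈ M.sets, IsModelBelow p C d ν → x ∈ ν

/-- A bounded form of `IsForced`, in which the sets `ν` are replaced by their codes. -/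
def IsForcedBy (p : Bool) (C : Set M.Num) (d m q x : M.Num) : Prop :=
  CodeBound d m q ∧ x < d ∧ ∀ n ≤ q, IsModelBelow p C d (codeSet (pair d (pair m n))) →
    InCode x (pair d (pair m n))

theorem CodeBound.isForcedBy_iff {p : Bool} {C : Set M.Num} {d m q x : M.Num}
    (h : CodeBound d m q) : IsForcedBy p C d m q x ↔ x < d ∧ IsForced p C d x := by
  refine ⟨fun ⟨_, hx, hF⟩ => ⟨hx, fun ν hν hmod => ?_⟩, fun ⟨hx, hF⟩ =>
    ⟨h, hx, fun n _ hmod => hF _ (codeSet_mem_sets _) hmod⟩⟩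
  obtain ⟨n, hn, hnν⟩ := h.exists_code hν
  refine ((hnν x).1 (hF n hn (hmod.congr fun y hy => ?_))).2
  exact ⟨fun hyν => (hnν y).2 ⟨hy, hyν⟩, fun hyn => ((hnν y).1 hyn).2⟩

section

variable {p : Bool} {C : Set M.Num} (hC : C ∈ M.sets)

include hC

theorem setOf_isForced_mem (d : M.Num) : {x | x < d ∧ IsForced p C d x} ∈ M.sets := by
  have := Fact.mk hC
  obtain ⟨m, q, h⟩ := exists_codeBound d
  simp only [← h.isForcedBy_iff]
  unfold IsForcedBy
  exact setOf_mem _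

/-- That some `d` forces `x` is a `Σ⁰₁` condition. -/
theorem exists_bddPred_isForced : ∃ Q : M.Num → M.Num → Prop,
    (BddPred fun e : ℕ → M.Num => Q (e 0) (e 1)) ∧ (∀ w x, Q w x → IsForced p C w x) ∧
      ∀ d x, x < d → IsForced p C d x → ∃ w, Q w x := by
  have := Fact.mk hC
  refine ⟨fun w x => ∃ d ≤ w, ∃ m ≤ w, ∃ q ≤ w, IsForcedBy p C d m q x, ?_, ?_, ?_⟩
  · unfold IsForcedBy CodeBound
    infer_instance
  · rintro w x ⟨d, hdw, m, -, q, -, h⟩ ν hν hmod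
    exact (h.1.isForcedBy_iff.1 h).2 ν hν (hmod.mono hdw)
  · intro d x hx hF
    obtain ⟨m, q, h⟩ := exists_codeBound d
    exact ⟨d + m + q, d, le_self_add.trans le_self_add, m, le_add_self.trans le_self_add, q,
      le_add_self, h.isForcedBy_iff.2 ⟨hx, hF⟩⟩

theorem exists_infinite_forced {L : Set M.Num} (hL : L ∈ M.sets)
    (h : ∀ b, ∃ d, ∃ x ∈ L, b < x ∧ x < d ∧ IsForced p C d x) :
    ∃ H ∈ M.sets, IsInf H ∧ ∀ x ∈ H, x ∈ L ∧ ∃ d, x < d ∧ IsForced p C d x := by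
  have := Fact.mk hL
  obtain ⟨Q, hQ, hQF, hFQ⟩ := exists_bddPred_isForced (p := p) hC
  obtain ⟨H, hH, hHinf, hHQ⟩ := exists_infinite_subset (fun w x => x ∈ L ∧ Q w x) fun b => by
    obtain ⟨d, x, hxL, hbx, hxd, hx⟩ := h b
    obtain ⟨w, hw⟩ := hFQ d x hxd hx
    exact ⟨x, hbx, w, hxL, hw⟩
  refine ⟨H, hH, hHinf, fun x hx => ?_⟩
  obtain ⟨w, hxL, hw⟩ := hHQ x hx
  exact ⟨hxL, w + x + 1, Num.lt_add_one_iff.2 le_add_self, fun ν hν hmod =>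
    hQF w x hw ν hν (hmod.mono (le_self_add.trans le_self_add))⟩

theorem exists_isForced_of_forall_lt {H : Set M.Num} (hH : H ∈ M.sets)
    (h : ∀ x ∈ H, ∃ d, x < d ∧ IsForced p C d x) (b : M.Num) :
    ∃ d, ∀ x ∈ H, x < b → IsForced p C d x := by
  have := Fact.mk hH
  obtain ⟨Q, hQ, hQF, hFQ⟩ := exists_bddPred_isForced (p := p) hC
  obtain ⟨d, hd⟩ := collection (fun w x => x ∈ H → Q w x) b fun x _ => by
    by_cases hx : x ∈ H
    · obtain ⟨d, hxd, hF⟩ := h x hx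
      obtain ⟨w, hw⟩ := hFQ d x hxd hF
      exact ⟨w, fun _ => hw⟩
    · exact ⟨0, fun hx' => absurd hx' hx⟩
  refine ⟨d, fun x hx hxb ν hν hmod => ?_⟩
  obtain ⟨w, hwd, hw⟩ := hd x hxb
  exact hQF w x (hw hx) ν hν (hmod.mono hwd.le)

theorem isHomogeneous_of_forced (hsat : FinSatisfiable C) {H : Set M.Num} (hH : H ∈ M.sets)
    (h : ∀ x ∈ H, ∃ d, x < d ∧ IsForced p C d x) : IsHomogeneous C H := by
  refine ⟨p, fun D ⟨_, b, hDb⟩ hDC => ?_⟩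
  obtain ⟨d, hd⟩ := exists_isForced_of_forall_lt hC hH h b
  obtain ⟨ν, hν, hmod⟩ := hsat.exists_isModelBelow hC p (d + b)
  have := Fact.mk hH
  have := Fact.mk hν
  have union_iff (y : M.Num) (hy : y < b) : y ∈ ν ↔ y ∈ ν ∨ y ∈ H :=
    ⟨.inl, fun h => h.elim id fun hyH => hd y hyH hy ν hν (hmod.mono le_self_add)⟩
  exact ⟨polar p {x | x ∈ ν ∨ x ∈ H}, polar_mem_sets p (setOf_mem fun x => x ∈ ν ∨ x ∈ H),
    fun φ hφ => (hmod.mono le_add_self).congr union_iff φ (hDb φ hφ) (hDC hφ),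
    fun x hx => by simp [mem_polar, hx]⟩

omit hC in
theorem isHomogeneous_of_isModelBelow_disjoint {H : Set M.Num}
    (h : ∀ d, ∃ ν ∈ M.sets, IsModelBelow p C d ν ∧ ∀ x ∈ H, x ∉ ν) : IsHomogeneous C H := by
  refine ⟨!p, fun D ⟨_, d, hDd⟩ hDC => ?_⟩
  obtain ⟨ν, hν, hmod, hνH⟩ := h d
  refine ⟨polar p ν, polar_mem_sets p hν, fun φ hφ => hmod φ (hDd φ hφ) (hDC hφ), fun x hx => ?_⟩
  cases p <;> simp [mem_polar, hνH x hx]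

theorem exists_homogeneous_of_least_models {L : Set M.Num} (hL : L ∈ M.sets) (hLinf : IsInf L)
    (hsat : FinSatisfiable C) (hleast : ∀ d, IsModelBelow p C d {x | x < d ∧ IsForced p C d x}) :
    ∃ H ∈ M.sets, H ⊆ L ∧ IsInf H ∧ IsHomogeneous C H := by
  by_cases hb : ∃ b, ∀ d, ∃ ν ∈ M.sets, IsModelBelow p C d ν ∧ ∀ x ∈ L, b < x → x ∉ ν
  · obtain ⟨b, hb⟩ := hb
    have := Fact.mk hL
    refine ⟨{x | x ∈ L ∧ b < x}, setOf_mem fun x => x ∈ L ∧ b < x, fun x hx => hx.1, fun a => ?_,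
      isHomogeneous_of_isModelBelow_disjoint (p := p) fun d => ?_⟩
    · obtain ⟨x, hx, hlt⟩ := hLinf (a + b)
      exact ⟨x, ⟨hx, le_add_self.trans_lt hlt⟩, le_self_add.trans_lt hlt⟩
    · obtain ⟨ν, hν, hmod, hνL⟩ := hb d
      exact ⟨ν, hν, hmod, fun x hx => hνL x hx.1 hx.2⟩
  · push Not at hb
    obtain ⟨H, hH, hHinf, hHL⟩ := exists_infinite_forced hC hL fun b => by
      obtain ⟨d, hd⟩ := hb b
      obtain ⟨x, hxL, hbx, hx⟩ := hd _ (setOf_isForced_mem hC d) (hleast d)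
      exact ⟨d, x, hxL, hbx, hx⟩
    exact ⟨H, hH, fun x hx => (hHL x hx).1, hHinf,
      isHomogeneous_of_forced hC hsat hH fun x hx => (hHL x hx).2⟩

end

/-! ### Horn and co-horn relations -/

/-- A clause with positive literals in `U` and negative literals in `W` is true in `ν`. -/
def SatisfiesClause {α : Type*} (U W ν : Set α) : Prop := W ⊆ ν → (U ∩ ν).Nonempty

omit hM in
theorem SatisfiesClause.sInter {α : Type*} {U W : Set α} (hU : U.Subsingleton) {𝓜 : Set (Set α)}
    (h𝓜 : 𝓜.Nonempty) (h : ∀ ν ∈ 𝓜, SatisfiesClause U W ν) : SatisfiesClause U W (⋂₀ 𝓜) := by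
  intro hW
  have meets (ν : Set α) (hν : ν ∈ 𝓜) : (U ∩ ν).Nonempty :=
    h ν hν (hW.trans (Set.sInter_subset_of_mem hν))
  obtain ⟨ν₀, hν₀⟩ := h𝓜
  obtain ⟨x, hxU, -⟩ := meets ν₀ hν₀
  refine ⟨x, hxU, fun ν hν => ?_⟩
  obtain ⟨y, hyU, hyν⟩ := meets ν hν
  exact hU hyU hxU ▸ hyν

/-- The coordinates at which the vector coded by `a` has the value `p`. -/
def valueSet (p : Bool) (a : M.Num) : Set M.Num := polar p (codeSet a)

omit hM in
theorem mem_valueSet {p : Bool} {a i : M.Num} : i ∈ valueSet p a ↔ (InCode i a ↔ p = true) :=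
  Iff.rfl

omit hM in
theorem mem_valueSet_iff {p : Bool} {a b i j : M.Num} :
    (i ∈ valueSet p a ↔ j ∈ valueSet p b) ↔ (InCode i a ↔ InCode j b) := by
  simp only [mem_valueSet]
  tauto

instance (p : Bool) (f g : (ℕ → M.Num) → M.Num) [BddTerm f] [BddTerm g] :
    BddPred fun e => f e ∈ valueSet p (g e) :=
  inferInstanceAs (BddPred fun e => InCode (f e) (g e) ↔ p = true)

theorem IsVec.mem_valueSet_iff_of_le {p : Bool} {n a b i : M.Num} (ha : IsVec n a)
    (hb : IsVec n b) (hi : n ≤ i) : i ∈ valueSet p a ↔ i ∈ valueSet p b :=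
  mem_valueSet_iff.2 <| iff_of_false (fun h => (ha.2 i h).not_ge hi) fun h => (hb.2 i h).not_ge hi

theorem IsVec.valueSet_subset_iff {p : Bool} {n a b : M.Num} (ha : IsVec n a) (hb : IsVec n b) :
    valueSet p a ⊆ valueSet p b ↔ {i | i < n ∧ i ∈ valueSet p a} ⊆ valueSet p b := by
  refine ⟨fun h i hi => h hi.2, fun h i hi => ?_⟩
  rcases lt_or_ge i n with hin | hin
  · exact h ⟨hin, hi⟩
  · exact (ha.mem_valueSet_iff_of_le hb hin).1 hi

theorem IsVec.eq_of_valueSet {p : Bool} {n a b : M.Num} (ha : IsVec n a) (hb : IsVec n b)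
    (h : valueSet p a = valueSet p b) : a = b :=
  ha.1.eq hb.1 fun i => mem_valueSet_iff.1 (by rw [h])

theorem IsVec.exists_valueSet_inter (p : Bool) {n a b : M.Num} (ha : IsVec n a) (hb : IsVec n b) :
    ∃ c, IsVec n c ∧ valueSet p c = valueSet p a ∩ valueSet p b := by
  obtain ⟨c, hc, hci⟩ := exists_vec n
    (polar_mem_sets p (setOf_mem fun i => i ∈ valueSet p a ∧ i ∈ valueSet p b))
  refine ⟨c, hc, Set.ext fun i => ?_⟩
  rcases lt_or_ge i n with hi | hi
  · rw [mem_valueSet, hci, and_iff_right hi, ← mem_polar, polar_polar]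
    rfl
  · simp only [Set.mem_inter_iff, hc.mem_valueSet_iff_of_le ha hi, hb.mem_valueSet_iff_of_le ha hi,
      and_self]

/-- The clause with the literals `i = p` for `i` in `k` and `i ≠ p` for `i` in `l`. -/
def polarClause : Bool → M.Num → M.Num → M.Num
  | true, k, l => pair k l
  | false, k, l => pair l k

theorem polarClause_inj {p : Bool} {k l k' l' : M.Num} :
    polarClause p k l = polarClause p k' l' ↔ k = k' ∧ l = l' := by
  cases p <;> simp [polarClause, pair_inj, and_comm]

theorem clauseHolds_polarClause {p : Bool} {k l a : M.Num} : ClauseHolds (polarClause p k l) a ↔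
    SatisfiesClause (codeSet k) (codeSet l) (valueSet p a) := by
  cases p <;>
    simp [polarClause, ClauseHolds, exists_pair_eq_iff, SatisfiesClause, Set.subset_def,
      Set.Nonempty, codeSet, mem_valueSet, imp_iff_not_or, or_comm]

/-- The number `c` codes a clause over the variables `i < n` with at most one literal `i = p`. -/
def IsPolarClause (p : Bool) (n c : M.Num) : Prop :=
  ∃ k l, c = polarClause p k l ∧ (codeSet k).Subsingleton ∧ (∀ i, InCode i k → i < n) ∧
    ∀ i, InCode i l → i < n

theorem isPolarClause_true {n c : M.Num} :
    IsPolarClause true n c ↔ IsClause n c ∧ HornClause c := by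
  constructor
  · rintro ⟨k, l, rfl, hsub, hk, hl⟩
    exact ⟨⟨k, l, rfl, hk, hl⟩, k, l, rfl, fun i j hi hj => hsub hi hj⟩
  · rintro ⟨⟨k, l, rfl, hk, hl⟩, h⟩
    exact ⟨k, l, rfl, fun i hi j hj => exists_pair_eq_iff.1 h i j hi hj, hk, hl⟩

theorem isPolarClause_false {n c : M.Num} :
    IsPolarClause false n c ↔ IsClause n c ∧ CoHornClause c := by
  constructor
  · rintro ⟨k, l, rfl, hsub, hk, hl⟩
    exact ⟨⟨l, k, rfl, hl, hk⟩, l, k, rfl, fun i j hi hj => hsub hi hj⟩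
  · rintro ⟨⟨l, k, rfl, hl, hk⟩, h⟩
    exact ⟨k, l, rfl, fun i hi j hj => exists_pair_eq_iff.1 h i j hi hj, hk, hl⟩

/-- The relation `(n, r)` is horn if `p` is `true`, and co-horn if `p` is `false`. -/
def PolarHorn (p : Bool) (n r : M.Num) : Prop :=
  ∃ f, (∀ c, InCode c f → IsPolarClause p n c) ∧
    ∀ a, IsVec n a → (InCode a r ↔ ∀ c, InCode c f → ClauseHolds c a)

theorem relHorn_pair {n r : M.Num} : RelHorn (pair n r) ↔ PolarHorn true n r := by
  simp only [RelHorn, exists_pair_eq_iff, PolarHorn, isPolarClause_true]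

theorem relCoHorn_pair {n r : M.Num} : RelCoHorn (pair n r) ↔ PolarHorn false n r := by
  simp only [RelCoHorn, exists_pair_eq_iff, PolarHorn, isPolarClause_false]

/-- The variables which the sequence coded by `s` has at the places in `k`. -/
def vars (s k : M.Num) : Set M.Num := {y | ∃ i, InCode i k ∧ InCode (pair i y) s}

theorem IsSeq.vars_subsingleton {n s k : M.Num} (hs : IsSeq n s) (hk : (codeSet k).Subsingleton) :
    (vars s k).Subsingleton := by
  rintro y ⟨i, hi, hy⟩ z ⟨j, hj, hz⟩
  obtain rfl := hk hi hj
  exact (hs.2.2 i (hs.lt_of_inCode hy)).unique hy hz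

omit hM in
theorem IsSeq.satisfiesClause_vars_iff {p : Bool} {n s k l a : M.Num} {ν : Set M.Num}
    (hs : IsSeq n s) (hk : ∀ i, InCode i k → i < n) (hl : ∀ i, InCode i l → i < n)
    (ha : ∀ i y, InCode (pair i y) s → (i ∈ valueSet p a ↔ y ∈ ν)) :
    SatisfiesClause (codeSet k) (codeSet l) (valueSet p a) ↔
      SatisfiesClause (vars s k) (vars s l) ν := by
  refine imp_congr ⟨?_, fun h i hi => ?_⟩ ⟨?_, ?_⟩
  · rintro h y ⟨i, hi, hy⟩
    exact (ha i y hy).1 (h hi)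
  · obtain ⟨y, hy, -⟩ := hs.2.2 i (hl i hi)
    exact (ha i y hy).2 (h ⟨i, hi, hy⟩)
  · rintro ⟨i, hi, hia⟩
    obtain ⟨y, hy, -⟩ := hs.2.2 i (hk i hi)
    exact ⟨y, ⟨i, hi, hy⟩, (ha i y hy).1 hia⟩
  · rintro ⟨y, ⟨i, hi, hy⟩, hyν⟩
    exact ⟨i, hi, (ha i y hy).2 hyν⟩

theorem satisfies_polar_iff {p : Bool} {n r s f : M.Num} (hrel : IsRel (pair n r)) (hs : IsSeq n s)
    (hf : ∀ c, InCode c f → IsPolarClause p n c)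
    (hr : ∀ a, IsVec n a → (InCode a r ↔ ∀ c, InCode c f → ClauseHolds c a))
    {ν : Set M.Num} (hν : ν ∈ M.sets) :
    Satisfies (polar p ν) (pair (pair n r) s) ↔
      ∀ k l, InCode (polarClause p k l) f → SatisfiesClause (vars s k) (vars s l) ν := by
  obtain ⟨a, ha, haν⟩ := hs.exists_vec (polar_mem_sets p hν)
  have value_iff (i y : M.Num) (hy : InCode (pair i y) s) : i ∈ valueSet p a ↔ y ∈ ν := by
    rw [mem_valueSet, haν i y hy, ← mem_polar, polar_polar]
  rw [satisfies_iff_inCode hrel hs ha haν, hr a ha]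
  constructor
  · intro h k l hkl
    obtain ⟨k', l', hkl', -, hk, hl⟩ := hf _ hkl
    obtain ⟨rfl, rfl⟩ := polarClause_inj.1 hkl'
    exact (hs.satisfiesClause_vars_iff hk hl value_iff).1 (clauseHolds_polarClause.1 (h _ hkl))
  · intro h c hc
    obtain ⟨k, l, rfl, -, hk, hl⟩ := hf c hc
    exact clauseHolds_polarClause.2 ((hs.satisfiesClause_vars_iff hk hl value_iff).2 (h k l hc))

theorem isModelBelow_setOf_isForced {p : Bool} {S V C : Set M.Num} (hC : C ∈ M.sets)
    (hform : ∀ φ ∈ C, IsFormulaOver S V φ) (hS : ∀ n r, pair n r ∈ S → PolarHorn p n r)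
    (hsat : FinSatisfiable C) (d : M.Num) :
    IsModelBelow p C d {x | x < d ∧ IsForced p C d x} := by
  intro φ hφd hφC
  obtain ⟨n, r, s, rfl, hnr, hrel, hs, -⟩ := hform φ hφC
  obtain ⟨f, hf, hr⟩ := hS n r hnr
  rw [satisfies_polar_iff hrel hs hf hr (setOf_isForced_mem hC d)]
  intro k l hkl hl
  obtain ⟨k', l', hkl', hk, -⟩ := hf _ hkl
  obtain ⟨rfl, rfl⟩ := polarClause_inj.1 hkl'
  have least : SatisfiesClause (vars s k) (vars s l) (⋂₀ {ν | ν ∈ M.sets ∧ IsModelBelow p C d ν}) :=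
    .sInter (hs.vars_subsingleton hk) (hsat.exists_isModelBelow hC p d) fun ν ⟨hν, hmod⟩ =>
      (satisfies_polar_iff hrel hs hf hr hν).1 (hmod _ hφd hφC) k l hkl
  obtain ⟨x, ⟨i, hi, hx⟩, hxν⟩ := least fun y hy ν ⟨hν, hmod⟩ => (hl hy).2 ν hν hmod
  exact ⟨x, ⟨i, hi, hx⟩, (lt_of_inCode_pair hx).trans hφd, fun ν hν hmod => hxν ν ⟨hν, hmod⟩⟩

theorem lrsat_of_polarHorn (p : Bool) {S : Set M.Num} (hS : ∀ n r, pair n r ∈ S → PolarHorn p n r) :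
    M.LRSAT S := fun _ _ _ hC _ hL _ _ hLinf hform hsat =>
  exists_homogeneous_of_least_models hC hL hLinf hsat
    (isModelBelow_setOf_isForced hC hform hS hsat)

/-- The relation coded by `ρ` contains the constant vector `(p, …, p)`. -/
def RelValid (p : Bool) (ρ : M.Num) : Prop :=
  ∃ n r, ρ = pair n r ∧ ∃ a, InCode a r ∧ ∀ i, i < n → i ∈ valueSet p a

omit hM in
theorem relValid_false {ρ : M.Num} : RelValid false ρ ↔ RelZeroValid ρ := by
  simp [RelValid, RelZeroValid, mem_valueSet]

omit hM in
theorem relValid_true {ρ : M.Num} : RelValid true ρ ↔ RelOneValid ρ := by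
  simp [RelValid, RelOneValid, mem_valueSet]

theorem lrsat_of_relValid (p : Bool) {S : Set M.Num} (hS : ∀ ρ ∈ S, RelValid p ρ) : M.LRSAT S := by
  intro V _ C _ L hL _ _ hLinf hform _
  refine ⟨L, hL, subset_rfl, hLinf, p, fun D _ hD =>
    ⟨{_y | p = true}, setOf_mem _, fun φ hφ => ?_, fun _ _ => Iff.rfl⟩⟩
  obtain ⟨n, r, s, rfl, hnr, -, hs, -⟩ := hform φ (hD hφ)
  obtain ⟨a, ha, hap⟩ := exists_pair_eq_iff.1 (hS _ hnr)
  exact satisfies_pair.2 ⟨a, ha, fun i y hy => hap i (hs.lt_of_inCode hy)⟩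

theorem lrsat_of_relTame {S : Set M.Num} (hS : RelTame S) : M.LRSAT S := by
  rcases hS with hS | hS | hS | hS
  · exact lrsat_of_relValid false fun ρ hρ => relValid_false.2 (hS ρ hρ)
  · exact lrsat_of_relValid true fun ρ hρ => relValid_true.2 (hS ρ hρ)
  · exact lrsat_of_polarHorn true fun n r h => relHorn_pair.1 (hS _ h)
  · exact lrsat_of_polarHorn false fun n r h => relCoHorn_pair.1 (hS _ h)

/-! ### Closure properties of horn and co-horn relations -/

/-- The relation coded by `r` is closed under the coordinatewise minimum if `p` is `true`, and under
the coordinatewise maximum if `p` is `false`. -/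
def PolarClosed (p : Bool) (n r : M.Num) : Prop :=
  ∀ a b c, InCode a r → InCode b r → IsVec n c →
    valueSet p c = valueSet p a ∩ valueSet p b → InCode c r

theorem PolarHorn.polarClosed {p : Bool} {n r : M.Num} (h : PolarHorn p n r)
    (hrel : IsRel (pair n r)) : PolarClosed p n r := by
  intro a b c ha hb hc hcab
  obtain ⟨f, hf, hr⟩ := h
  have holds {a : M.Num} (ha : InCode a r) : ∀ C, InCode C f → ClauseHolds C a :=
    (hr a ((isRel_pair.1 hrel).2 a ha)).1 ha
  refine (hr c hc).2 fun C hC => ?_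
  obtain ⟨k, l, rfl, hk, -⟩ := hf C hC
  rw [clauseHolds_polarClause, hcab, ← Set.sInter_pair]
  refine .sInter hk (Set.insert_nonempty _ _) ?_
  rintro _ (rfl | rfl)
  exacts [clauseHolds_polarClause.1 (holds ha _ hC), clauseHolds_polarClause.1 (holds hb _ hC)]

theorem valueSet_subset_iff_forall_lt {p : Bool} {a b : M.Num} :
    valueSet p a ⊆ valueSet p b ↔ ∀ i < a + b, i ∈ valueSet p a → i ∈ valueSet p b := by
  refine ⟨fun h i _ hi => h hi, fun h i hi => ?_⟩
  by_cases hiab : i < a + b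
  · exact h i hiab hi
  · refine (mem_valueSet_iff.2 (iff_of_false (fun hia => hiab ?_) fun hib => hiab ?_)).1 hi
    exacts [hia.lt.trans_le le_self_add, hib.lt.trans_le le_add_self]

instance (p : Bool) (f g : (ℕ → M.Num) → M.Num) [BddTerm f] [BddTerm g] :
    BddPred fun e => valueSet p (f e) ⊆ valueSet p (g e) :=
  have : BddPred fun e : ℕ → M.Num => valueSet p (e 0) ⊆ valueSet p (e 1) :=
    .congr fun _ => valueSet_subset_iff_forall_lt
  this.subst₂ (P := fun a b => valueSet p a ⊆ valueSet p b) f g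

theorem PolarClosed.exists_least {p : Bool} {n r a b : M.Num} (h : PolarClosed p n r)
    (hrel : IsRel (pair n r)) (hb : InCode b r) (hab : valueSet p a ⊆ valueSet p b) :
    ∃ c, InCode c r ∧ valueSet p a ⊆ valueSet p c ∧
      ∀ b, InCode b r → valueSet p a ⊆ valueSet p b → valueSet p c ⊆ valueSet p b := by
  have hvec := (isRel_pair.1 hrel).2
  obtain ⟨c, hc, hac, hmin⟩ := bdd_ind (fun k => ∃ c, InCode c r ∧ valueSet p a ⊆ valueSet p c ∧
    ∀ b < k, InCode b r → valueSet p a ⊆ valueSet p b → valueSet p c ⊆ valueSet p b)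
    ⟨b, hb, hab, fun _ h => absurd h not_lt_zero⟩ (fun k ⟨c, hc, hac, hmin⟩ => by
      by_cases hk : InCode k r ∧ valueSet p a ⊆ valueSet p k
      · obtain ⟨d, hd, hdck⟩ := (hvec c hc).exists_valueSet_inter p (hvec k hk.1)
        refine ⟨d, h c k d hc hk.1 hd hdck, hdck ▸ Set.subset_inter hac hk.2,
          fun b hb hbr hab => ?_⟩
        rw [hdck]
        rcases (Num.lt_add_one_iff.1 hb).lt_or_eq with hb | rfl
        · exact Set.inter_subset_left.trans (hmin b hb hbr hab)
        · exact Set.inter_subset_right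
      · refine ⟨c, hc, hac, fun b hb hbr hab => ?_⟩
        rcases (Num.lt_add_one_iff.1 hb).lt_or_eq with hb | rfl
        · exact hmin b hb hbr hab
        · exact absurd ⟨hbr, hab⟩ hk) r
  exact ⟨c, hc, hac, fun b hb => hmin b hb.lt hb⟩

/-- The sets of literals `U` and `W` give a clause of the given polarity that holds throughout the
relation `(n, r)`. -/
def IsPolarImplicate (p : Bool) (n r : M.Num) (U W : Set M.Num) : Prop :=
  U.Subsingleton ∧ (∀ i ∈ U, i < n) ∧ (∀ i ∈ W, i < n) ∧
    ∀ b, InCode b r → SatisfiesClause U W (valueSet p b)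

theorem PolarClosed.inCode {p : Bool} {n r a : M.Num} (h : PolarClosed p n r)
    (hrel : IsRel (pair n r)) (ha : IsVec n a)
    (hcl : ∀ U ∈ M.sets, ∀ W ∈ M.sets, IsPolarImplicate p n r U W →
      SatisfiesClause U W (valueSet p a)) : InCode a r := by
  have hvec := (isRel_pair.1 hrel).2
  let W := {i | i < n ∧ i ∈ valueSet p a}
  have hW : W ∈ M.sets := setOf_mem fun i => i < n ∧ i ∈ valueSet p a
  have above_iff {b : M.Num} (hb : InCode b r) : W ⊆ valueSet p b ↔ valueSet p a ⊆ valueSet p b :=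
    (ha.valueSet_subset_iff (hvec b hb)).symm
  obtain ⟨b, hb, hab⟩ : ∃ b, InCode b r ∧ valueSet p a ⊆ valueSet p b := by
    by_contra! hne
    obtain ⟨i, hi, -⟩ := hcl ∅ empty_mem_sets W hW ⟨Set.subsingleton_empty, by simp,
      fun i => And.left, fun b hb hWb => absurd ((above_iff hb).1 hWb) (hne b hb)⟩
      fun i => And.right
    exact hi
  obtain ⟨c, hc, hac, hmin⟩ := h.exists_least hrel hb hab
  have hca : valueSet p c ⊆ valueSet p a := by
    refine ((hvec c hc).valueSet_subset_iff ha).2 fun j ⟨hj, hjc⟩ => ?_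
    obtain ⟨_, rfl, hja⟩ := hcl {j} (setOf_mem fun i => i = j) W hW ⟨Set.subsingleton_singleton,
      by simpa using hj, fun i => And.left,
      fun b hb hWb => ⟨j, rfl, hmin b hb ((above_iff hb).1 hWb) hjc⟩⟩ fun i => And.right
    exact hja
  exact ha.eq_of_valueSet (hvec c hc) (hac.antisymm hca) ▸ hc

instance (p : Bool) (f g : (ℕ → M.Num) → M.Num) [BddTerm f] [BddTerm g] :
    BddTerm fun e => polarClause p (f e) (g e) := by
  cases p
  exacts [inferInstanceAs (BddTerm fun e => pair (g e) (f e)),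
    inferInstanceAs (BddTerm fun e => pair (f e) (g e))]

theorem polarClause_le {p : Bool} {k l K : M.Num} (hk : k ≤ K) (hl : l ≤ K) :
    polarClause p k l ≤ pair K K := by
  cases p
  exacts [pair_le_pair hl hk, pair_le_pair hk hl]

theorem bddPred_isPolarImplicate (p : Bool) (n r : M.Num) :
    BddPred fun e : ℕ → M.Num => IsPolarImplicate p n r (codeSet (e 0)) (codeSet (e 1)) :=
  inferInstanceAs (BddPred fun e : ℕ → M.Num =>
    (∀ i, InCode i (e 0) → ∀ j, InCode j (e 0) → i = j) ∧ (∀ i, InCode i (e 0) → i < n) ∧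
      (∀ i, InCode i (e 1) → i < n) ∧
        ∀ b, InCode b r → (∀ i, InCode i (e 1) → i ∈ valueSet p b) →
          ∃ i, InCode i (e 0) ∧ i ∈ valueSet p b)

theorem exists_codeSet_eq (n : M.Num) :
    ∃ K, ∀ X ∈ M.sets, (∀ i ∈ X, i < n) → ∃ k ≤ K, codeSet k = X := by
  obtain ⟨m, q, h⟩ := exists_codeBound n
  refine ⟨pair n (pair m q), fun X hX hXn => ?_⟩
  obtain ⟨k, hk, hkX⟩ := h.exists_code hX
  exact ⟨_, pair_le_pair le_rfl (pair_le_pair le_rfl hk),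
    Set.ext fun i => (hkX i).trans (and_iff_right_of_imp (hXn i))⟩

theorem exists_coded_polarImplicates (p : Bool) (n r : M.Num) : ∃ f,
    (∀ c, InCode c f → ∃ k l, c = polarClause p k l ∧
      IsPolarImplicate p n r (codeSet k) (codeSet l)) ∧
    ∀ U ∈ M.sets, ∀ W ∈ M.sets, IsPolarImplicate p n r U W →
      ∃ k l, InCode (polarClause p k l) f ∧ codeSet k = U ∧ codeSet l = W := by
  obtain ⟨K, hK⟩ := exists_codeSet_eq n
  have (f g : (ℕ → M.Num) → M.Num) [BddTerm f] [BddTerm g] :=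
    (bddPred_isPolarImplicate p n r).subst₂
      (P := fun k l => IsPolarImplicate p n r (codeSet k) (codeSet l)) f g
  obtain ⟨f, -, hf⟩ := exists_finCode (b := pair K K + 1)
    (setOf_mem fun c => ∃ k ≤ K, ∃ l ≤ K, c = polarClause p k l ∧
      IsPolarImplicate p n r (codeSet k) (codeSet l)) (by
        rintro _ ⟨k, hk, l, hl, rfl, -⟩
        exact Num.lt_add_one_iff.2 (polarClause_le hk hl))
  refine ⟨f, fun c hc => ?_, fun U hU W hW hUW => ?_⟩
  · obtain ⟨k, -, l, -, h⟩ := (hf c).1 hc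
    exact ⟨k, l, h⟩
  · obtain ⟨k, hk, rfl⟩ := hK U hU hUW.2.1
    obtain ⟨l, hl, rfl⟩ := hK W hW hUW.2.2.1
    exact ⟨k, l, (hf _).2 ⟨k, hk, l, hl, rfl, hUW⟩, rfl, rfl⟩

theorem PolarClosed.polarHorn {p : Bool} {n r : M.Num} (h : PolarClosed p n r)
    (hrel : IsRel (pair n r)) : PolarHorn p n r := by
  obtain ⟨f, hf, hf'⟩ := exists_coded_polarImplicates p n r
  refine ⟨f, fun c hc => ?_, fun a ha => ⟨fun har c hc => ?_, fun hfa => ?_⟩⟩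
  · obtain ⟨k, l, rfl, hsub, hk, hl, -⟩ := hf c hc
    exact ⟨k, l, rfl, hsub, hk, hl⟩
  · obtain ⟨k, l, rfl, -, -, -, hr⟩ := hf c hc
    exact clauseHolds_polarClause.2 (hr a har)
  · refine h.inCode hrel ha fun U hU W hW hUW => ?_
    obtain ⟨k, l, hkl, rfl, rfl⟩ := hf' U hU W hW hUW
    exact clauseHolds_polarClause.1 (hfa _ hkl)

theorem polarHorn_iff_polarClosed {p : Bool} {n r : M.Num} (hrel : IsRel (pair n r)) :
    PolarHorn p n r ↔ PolarClosed p n r := ⟨fun h => h.polarClosed hrel, fun h => h.polarHorn hrel⟩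


/-! ### Codes of standard relations -/

omit hM in
theorem exists_boolVec (a : M.Num) (n : ℕ) :
    ∃ v : Fin n → Bool, ∀ i : Fin n, InCode (M.num i) a ↔ v i = true := by
  classical
  exact ⟨fun i => decide (InCode (M.num i) a), fun i => by simp⟩

theorem lt_num_iff {n : ℕ} {x : M.Num} : x < M.num n ↔ ∃ i : Fin n, x = M.num i := by
  induction n with
  | zero => simp [num, hM.out.not_lt_zero]
  | succ n ih =>
    rw [num, hM.out.lt_succ_iff, ih, Fin.exists_fin_succ']
    simp only [Fin.val_castSucc, Fin.val_last]

theorem num_strictMono : StrictMono M.num :=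
  strictMono_nat_of_lt_succ fun _ => Num.lt_add_one_iff.2 le_rfl

theorem mem_sets_of_finite {X : Set M.Num} (hX : X.Finite) : X ∈ M.sets := by
  induction X, hX using Set.Finite.induction_on with
  | empty => exact empty_mem_sets
  | @insert a X _ _ ih =>
    have := Fact.mk ih
    exact setOf_mem fun x => x = a ∨ x ∈ X

theorem exists_finCode_of_finite {X : Set M.Num} (hX : X.Finite) :
    ∃ c, IsFinCode c ∧ ∀ i, InCode i c ↔ i ∈ X := by
  obtain ⟨b, hb⟩ := hX.bddAbove
  exact exists_finCode (mem_sets_of_finite hX) fun i hi => Num.lt_add_one_iff.2 (hb hi)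

theorem exists_finCode_of_finset {n : ℕ} (s : Finset (Fin n)) :
    ∃ c : M.Num, IsFinCode c ∧ ∀ x, InCode x c ↔ ∃ i ∈ s, x = M.num i := by
  obtain ⟨c, hc, h⟩ := exists_finCode_of_finite (s.finite_toSet.image fun i : Fin n => M.num i)
  exact ⟨c, hc, fun x => by simp [h, eq_comm]⟩

theorem exists_vec_num {n : ℕ} (v : Fin n → Bool) :
    ∃ a, IsVec (M.num n) a ∧ ∀ i : Fin n, InCode (M.num i) a ↔ v i = true := by
  obtain ⟨a, ha, h⟩ := exists_finCode_of_finset (M := M) {i | v i = true}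
  refine ⟨a, ⟨ha, fun i hi => ?_⟩, fun i => ?_⟩
  · obtain ⟨j, -, rfl⟩ := (h i).1 hi
    exact lt_num_iff.2 ⟨j, rfl⟩
  · simp [h, num_strictMono.injective.eq_iff, Fin.val_inj]

theorem isVec_num_eq {n : ℕ} {a b : M.Num} (ha : IsVec (M.num n) a) (hb : IsVec (M.num n) b)
    (h : ∀ i : Fin n, InCode (M.num i) a ↔ InCode (M.num i) b) : a = b :=
  ha.eq hb fun i hi => by
    obtain ⟨j, rfl⟩ := lt_num_iff.1 hi
    exact h j

theorem exists_codes (R : BoolRel) : ∃ ρ : M.Num, Codes ρ R := by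
  choose a ha hav using fun v : Fin R.arity → Bool => exists_vec_num (M := M) v
  obtain ⟨r, hr, h⟩ := exists_finCode_of_finite (R.carrier.toFinite.image a)
  refine ⟨_, isRel_pair.2 ⟨hr, fun b hb => ?_⟩, r, rfl, fun v => ⟨fun hv => ?_, ?_⟩⟩
  · obtain ⟨v, -, rfl⟩ := (h b).1 hb
    exact ha v
  · exact ⟨a v, (h _).2 ⟨v, hv, rfl⟩, hav v⟩
  · rintro ⟨b, hb, hbv⟩
    obtain ⟨w, hw, rfl⟩ := (h b).1 hb
    have : w = v := funext fun i => by rw [Bool.eq_iff_iff, ← hav w i, hbv i]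
    exact this ▸ hw

theorem Codes.exists_eq {ρ : M.Num} {R : BoolRel} (h : Codes ρ R) :
    ∃ r, ρ = pair (M.num R.arity) r ∧ IsRel (pair (M.num R.arity) r) ∧
      ∀ (a : M.Num) (v : Fin R.arity → Bool), IsVec (M.num R.arity) a →
        (∀ i : Fin R.arity, InCode (M.num i) a ↔ v i = true) → (InCode a r ↔ v ∈ R.carrier) := by
  obtain ⟨hrel, r, rfl, hr⟩ := h
  refine ⟨r, rfl, hrel, fun a v ha hav => ?_⟩
  rw [hr v]
  refine ⟨fun h => ⟨a, h, hav⟩, fun ⟨b, hb, hbv⟩ => ?_⟩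
  rwa [isVec_num_eq ha ((isRel_pair.1 hrel).2 b hb) fun i => (hav i).trans (hbv i).symm]

theorem Codes.eq {ρ ρ' : M.Num} {R : BoolRel} (h : Codes ρ R) (h' : Codes ρ' R) : ρ = ρ' := by
  obtain ⟨r, rfl, hrel, hr⟩ := h.exists_eq
  obtain ⟨r', rfl, hrel', hr'⟩ := h'.exists_eq
  rw [isRel_pair] at hrel hrel'
  rw [hrel.1.eq hrel'.1 fun a => ?_]
  obtain ⟨v, hv⟩ := exists_boolVec a R.arity
  exact ⟨fun ha => (hr' a v (hrel.2 a ha) hv).2 ((hr a v (hrel.2 a ha) hv).1 ha),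
    fun ha => (hr a v (hrel'.2 a ha) hv).2 ((hr' a v (hrel'.2 a ha) hv).1 ha)⟩

/-! ### Templates -/

/-- A gadget: a relation `(n, r)` and two vectors `b`, `c`, standing for the formula
`R(y₀, …, yₙ₋₁)` in four variables `x`, `z`, `t`, `f` in which `yᵢ` is `t`, `f`, `x`, `z` according
as `(bᵢ, cᵢ)` is `(1, 1)`, `(0, 0)`, `(1, 0)`, `(0, 1)`. -/
structure Template (M : L2Structure.{u}) where
  n : M.Num
  r : M.Num
  b : M.Num
  c : M.Num

namespace Template

/-- Among the propositions `X`, `Z`, `T`, `F` about the variables `x`, `z`, `t`, `f`, the one about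
the variable `yᵢ`. -/
def Select (τ : Template M) (X Z T F : Prop) (i : M.Num) : Prop :=
  (InCode i τ.b ∧ InCode i τ.c ∧ T) ∨ (¬ InCode i τ.b ∧ ¬ InCode i τ.c ∧ F) ∨
    (InCode i τ.b ∧ ¬ InCode i τ.c ∧ X) ∨ (¬ InCode i τ.b ∧ InCode i τ.c ∧ Z)

/-- `ψ` is the formula given by the template and by the variables `x`, `z`, `t`, `f`. -/
def IsInstance (τ : Template M) (x z t f ψ : M.Num) : Prop :=
  ∃ s, ψ = pair (pair τ.n τ.r) s ∧ IsFinCode s ∧ ∀ q, InCode q s ↔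
    ∃ i y, i < τ.n ∧ q = pair i y ∧ τ.Select (y = x) (y = z) (y = t) (y = f) i

/-- The template is satisfied by the truth values `X`, `Z`, `T`, `F` of `x`, `z`, `t`, `f`. -/
def Holds (τ : Template M) (X Z T F : Prop) : Prop :=
  ∃ a, InCode a τ.r ∧ ∀ i, i < τ.n → (InCode i a ↔ τ.Select X Z T F i)

/-- The variables `x` and `z` do not occur in the formula of the template. -/
def IsConst (τ : Template M) : Prop :=
  ∀ i < τ.n, InCode i τ.b ↔ InCode i τ.c

/-- Both variables `x` and `z` occur in the formula of the template. -/
def Mentions (τ : Template M) : Prop :=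
  (∃ i < τ.n, InCode i τ.b ∧ ¬ InCode i τ.c) ∧ ∃ i < τ.n, ¬ InCode i τ.b ∧ InCode i τ.c

/-- The formula of the template is an `S`-formula, and is satisfied by `x ≠ z`, `t = 1`, `f = 0`.
For the instances with `x`, `z` from a given set of pairs to be computable, `x` and `z` have to be
bounded by the instance whenever they matter, hence the last condition. -/
structure Admissible (S : Set M.Num) (τ : Template M) : Prop where
  mem : pair τ.n τ.r ∈ S
  isRel : IsRel (pair τ.n τ.r)
  left_mem : InCode τ.b τ.r
  right_mem : InCode τ.c τ.r
  isConst_or_mentions : τ.IsConst ∨ τ.Mentions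

variable {τ : Template M} {x z t f i y ψ : M.Num}

omit hM in
theorem select_iff_exists {P : M.Num → Prop} : τ.Select (P x) (P z) (P t) (P f) i ↔
    ∃ y, τ.Select (y = x) (y = z) (y = t) (y = f) i ∧ P y := by
  unfold Select
  by_cases hb : InCode i τ.b <;> by_cases hc : InCode i τ.c <;> simp [hb, hc]

omit hM in
variable (τ x z t f i) in
theorem existsUnique_select : ∃! y, τ.Select (y = x) (y = z) (y = t) (y = f) i := by
  unfold Select
  by_cases hb : InCode i τ.b <;> by_cases hc : InCode i τ.c <;> simp [hb, hc]

omit hM in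
theorem holds_of_left (h : InCode τ.b τ.r) : τ.Holds True False True False :=
  ⟨τ.b, h, fun i _ => by unfold Select; tauto⟩

omit hM in
theorem holds_of_right (h : InCode τ.c τ.r) : τ.Holds False True True False :=
  ⟨τ.c, h, fun i _ => by unfold Select; tauto⟩

omit hM in
theorem Admissible.holds {S : Set M.Num} (hτ : τ.Admissible S) {X Z : Prop}
    (h : τ.IsConst ∨ ¬ (X ↔ Z)) : τ.Holds X Z True False := by
  rcases h with hconst | hXZ
  · refine ⟨τ.b, hτ.left_mem, fun i hi => ?_⟩
    have := hconst i hi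
    unfold Select
    tauto
  · by_cases hX : X
    · have hZ : ¬ Z := fun hZ => hXZ (iff_of_true hX hZ)
      simpa only [hX, hZ] using holds_of_left hτ.left_mem
    · have hZ : Z := not_not.1 fun hZ => hXZ (iff_of_false hX hZ)
      simpa only [hX, hZ] using holds_of_right hτ.right_mem

theorem le_of_select (h : τ.Select (y = x) (y = z) (y = t) (y = f) i) : y ≤ x + z + t + f := by
  rcases h with ⟨-, -, rfl⟩ | ⟨-, -, rfl⟩ | ⟨-, -, rfl⟩ | ⟨-, -, rfl⟩
  · exact le_add_self.trans le_self_add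
  · exact le_add_self
  · exact le_self_add.trans (le_self_add.trans le_self_add)
  · exact le_add_self.trans (le_self_add.trans le_self_add)

instance (X Z T F : (ℕ → M.Num) → Prop) (g : (ℕ → M.Num) → M.Num)
    [BddPred X] [BddPred Z] [BddPred T] [BddPred F] [BddTerm g] :
    BddPred fun e => τ.Select (X e) (Z e) (T e) (F e) (g e) := by
  unfold Select
  infer_instance

theorem isInstance_iff_exists_le : τ.IsInstance x z t f ψ ↔
    ∃ s ≤ ψ, ψ = pair (pair τ.n τ.r) s ∧ IsFinCode s ∧
      (∀ q, InCode q s → ∃ i < τ.n, ∃ y ≤ x + z + t + f,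
        q = pair i y ∧ τ.Select (y = x) (y = z) (y = t) (y = f) i) ∧
      ∀ i < τ.n, ∀ y ≤ x + z + t + f,
        τ.Select (y = x) (y = z) (y = t) (y = f) i → InCode (pair i y) s := by
  constructor
  · rintro ⟨s, rfl, hs, h⟩
    refine ⟨s, right_le_pair _ _, rfl, hs, fun q hq => ?_,
      fun i hi y _ hy => (h _).2 ⟨i, y, hi, rfl, hy⟩⟩
    obtain ⟨i, y, hi, rfl, hy⟩ := (h q).1 hq
    exact ⟨i, hi, y, le_of_select hy, rfl, hy⟩
  · rintro ⟨s, -, rfl, hs, h₁, h₂⟩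
    refine ⟨s, rfl, hs, fun q => ⟨fun hq => ?_, ?_⟩⟩
    · obtain ⟨i, hi, y, -, hy⟩ := h₁ q hq
      exact ⟨i, y, hi, hy⟩
    · rintro ⟨i, y, hi, rfl, hy⟩
      exact h₂ i hi y (le_of_select hy) hy

instance (t f : M.Num) (g h k : (ℕ → M.Num) → M.Num) [BddTerm g] [BddTerm h] [BddTerm k] :
    BddPred fun e => τ.IsInstance (g e) (h e) t f (k e) := by
  have : BddPred fun e : ℕ → M.Num => τ.IsInstance (e 0) (e 1) t f (e 2) :=
    .congr fun e => isInstance_iff_exists_le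
  exact this.subst₃ (P := fun x z ψ => τ.IsInstance x z t f ψ) g h k

variable (τ x z t f) in
theorem exists_isInstance : ∃ ψ, τ.IsInstance x z t f ψ := by
  have hX := setOf_mem fun q => ∃ i < τ.n, ∃ y ≤ x + z + t + f, q = pair i y ∧
    τ.Select (y = x) (y = z) (y = t) (y = f) i
  obtain ⟨s, hs, h⟩ := exists_finCode (b := pair τ.n (x + z + t + f) + 1) hX (by
    rintro _ ⟨i, hi, y, hy, rfl, -⟩
    exact Num.lt_add_one_iff.2 (pair_le_pair hi.le hy))
  refine ⟨_, s, rfl, hs, fun q => (h q).trans ⟨?_, ?_⟩⟩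
  · rintro ⟨i, hi, y, -, h⟩
    exact ⟨i, y, hi, h⟩
  · rintro ⟨i, y, hi, rfl, hy⟩
    exact ⟨i, hi, y, le_of_select hy, rfl, hy⟩

namespace IsInstance

theorem unique {ψ' : M.Num} (h : τ.IsInstance x z t f ψ) (h' : τ.IsInstance x z t f ψ') :
    ψ = ψ' := by
  obtain ⟨s, rfl, hs, h⟩ := h
  obtain ⟨s', rfl, hs', h'⟩ := h'
  rw [hs.eq hs' fun q => (h q).trans (h' q).symm]

theorem exists_isSeq (h : τ.IsInstance x z t f ψ) : ∃ s, ψ = pair (pair τ.n τ.r) s ∧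
    IsSeq τ.n s ∧ ∀ i y, InCode (pair i y) s ↔
      i < τ.n ∧ τ.Select (y = x) (y = z) (y = t) (y = f) i := by
  obtain ⟨s, rfl, hs, h⟩ := h
  have h' (i y : M.Num) : InCode (pair i y) s ↔
      i < τ.n ∧ τ.Select (y = x) (y = z) (y = t) (y = f) i := by
    simp only [h, ← and_left_comm (a := pair i y = _), exists_pair_eq_iff]
  refine ⟨s, rfl, ⟨hs, fun q hq => ?_, fun i hi => ?_⟩, h'⟩
  · obtain ⟨i, y, hi, rfl, -⟩ := (h q).1 hq
    exact ⟨i, y, hi, rfl⟩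
  · simp only [h', and_iff_right hi]
    exact existsUnique_select τ x z t f i

theorem satisfies_iff (h : τ.IsInstance x z t f ψ) (ν : Set M.Num) :
    Satisfies ν ψ ↔ τ.Holds (x ∈ ν) (z ∈ ν) (t ∈ ν) (f ∈ ν) := by
  obtain ⟨s, rfl, -, h⟩ := h.exists_isSeq
  rw [satisfies_pair]
  refine exists_congr fun a => and_congr_right fun _ => ?_
  simp only [h, and_imp]
  refine forall_congr' fun i => forall_comm.trans (forall_congr' fun _ => ?_)
  obtain ⟨y, hy, huniq⟩ := existsUnique_select τ x z t f i
  have hyν : τ.Select (x ∈ ν) (z ∈ ν) (t ∈ ν) (f ∈ ν) i ↔ y ∈ ν := by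
    rw [select_iff_exists (P := (· ∈ ν))]
    exact ⟨fun ⟨w, hw, hwν⟩ => huniq w hw ▸ hwν, fun hyν => ⟨y, hy, hyν⟩⟩
  rw [hyν]
  exact ⟨fun ha => ha y hy, fun ha w hw => huniq w hw ▸ ha⟩

theorem isFormulaOver (h : τ.IsInstance x z t f ψ) {S : Set M.Num} (hS : pair τ.n τ.r ∈ S)
    (hrel : IsRel (pair τ.n τ.r)) : IsFormulaOver S Set.univ ψ := by
  obtain ⟨s, rfl, hs, -⟩ := h.exists_isSeq
  exact ⟨_, _, s, rfl, hS, hrel, hs, fun _ _ _ => trivial⟩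

theorem lt_of_select (h : τ.IsInstance x z t f ψ) (hi : i < τ.n)
    (hy : τ.Select (y = x) (y = z) (y = t) (y = f) i) : y < ψ := by
  obtain ⟨s, rfl, -, h⟩ := h.exists_isSeq
  exact lt_of_inCode_pair ((h i y).2 ⟨hi, hy⟩)

omit hM in
theorem change_vars (h : τ.IsInstance x z t f ψ) (hτ : τ.IsConst) (x' z' : M.Num) :
    τ.IsInstance x' z' t f ψ := by
  obtain ⟨s, hψ, hs, h⟩ := h
  refine ⟨s, hψ, hs, fun q => (h q).trans (exists₂_congr fun i y => and_congr_right fun hi => ?_)⟩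
  have := hτ i hi
  unfold Select
  tauto

end IsInstance

end Template

/-- The gadget of the relation `[x ≠ y]` itself, in which `y₀` is `x` and `y₁` is `z`. -/
structure IsNeqTemplate (σ : Template M) : Prop where
  n_eq : σ.n = M.num 2
  codes : Codes (pair σ.n σ.r) BoolRel.neq
  select_zero : ∀ X Z T F, σ.Select X Z T F (M.num 0) ↔ X
  select_one : ∀ X Z T F, σ.Select X Z T F (M.num 1) ↔ Z

theorem exists_isNeqTemplate : ∃ σ : Template M, IsNeqTemplate σ := by
  obtain ⟨ρ, hρ⟩ := exists_codes (M := M) BoolRel.neq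
  obtain ⟨r, rfl, -⟩ := hρ.exists_eq
  obtain ⟨b, -, hb⟩ := exists_vec_num (M := M) ![true, false]
  obtain ⟨c, -, hc⟩ := exists_vec_num (M := M) ![false, true]
  simp only [Fin.forall_fin_two, Fin.val_zero, Fin.val_one, Matrix.cons_val_zero,
    Matrix.cons_val_one, iff_true, Bool.false_eq_true, iff_false] at hb hc
  exact ⟨⟨M.num 2, r, b, c⟩, rfl, hρ, fun X Z T F => by simp [Template.Select, hb, hc],
    fun X Z T F => by simp [Template.Select, hb, hc]⟩

namespace IsNeqTemplate

variable {σ : Template M}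

theorem forall_lt_iff (hσ : IsNeqTemplate σ) {P : M.Num → Prop} :
    (∀ i < σ.n, P i) ↔ P (M.num 0) ∧ P (M.num 1) := by
  simp only [hσ.n_eq, lt_num_iff, Fin.exists_fin_two, or_imp, forall_and, forall_eq, Fin.val_zero,
    Fin.val_one]

theorem holds_iff (hσ : IsNeqTemplate σ) {X Z T F : Prop} : σ.Holds X Z T F ↔ ¬ (X ↔ Z) := by
  classical
  obtain ⟨r, hr, hrel, hcodes⟩ := hσ.codes.exists_eq
  obtain ⟨-, rfl⟩ := pair_inj.1 hr
  have hval (a : M.Num) : (∀ i < σ.n, (InCode i a ↔ σ.Select X Z T F i)) ↔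
      (InCode (M.num 0) a ↔ X) ∧ (InCode (M.num 1) a ↔ Z) := by
    rw [hσ.forall_lt_iff, hσ.select_zero, hσ.select_one]
  simp only [Template.Holds, hval]
  constructor
  · rintro ⟨a, ha, hX, hZ⟩
    obtain ⟨v, hv⟩ := exists_boolVec a 2
    have hvR : v 0 ≠ v 1 := (hcodes a v ((isRel_pair.1 hrel).2 a ha) hv).1 ha
    rw [← hX, ← hZ]
    exact fun h => hvR (Bool.eq_iff_iff.2 ((hv 0).symm.trans (h.trans (hv 1))))
  · intro hXZ
    obtain ⟨a, ha, hav⟩ := exists_vec_num (M := M) ![decide X, decide Z]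
    refine ⟨a, (hcodes a _ ha hav).2 fun h => hXZ (decide_eq_decide.1 h), ?_⟩
    simpa [Fin.forall_fin_two] using hav

theorem exists_isInstance_of_isFormulaOver (hσ : IsNeqTemplate σ) {V : Set M.Num} {φ : M.Num}
    (h : IsFormulaOver (M.codesOf {BoolRel.neq}) V φ) :
    ∃ x < φ, ∃ z < φ, σ.IsInstance x z 0 0 φ := by
  obtain ⟨n, r, s, rfl, ⟨R, rfl, hR⟩, -, ⟨hfin, hpairs, hs⟩, -⟩ := h
  obtain ⟨rfl, rfl⟩ := pair_inj.1 (hR.eq hσ.codes)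
  obtain ⟨⟨x, hx, hx_unique⟩, z, hz, hz_unique⟩ := hσ.forall_lt_iff.1 hs
  have hsel : ∀ i < σ.n, ∀ y, σ.Select (y = x) (y = z) (y = 0) (y = 0) i ↔ InCode (pair i y) s := by
    rw [hσ.forall_lt_iff]
    simp only [hσ.select_zero, hσ.select_one]
    exact ⟨fun y => ⟨fun h => h ▸ hx, hx_unique y⟩, fun y => ⟨fun h => h ▸ hz, hz_unique y⟩⟩
  refine ⟨x, lt_of_inCode_pair hx, z, lt_of_inCode_pair hz, s, rfl, hfin,
    fun q => ⟨fun hq => ?_, ?_⟩⟩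
  · obtain ⟨i, y, hi, rfl⟩ := hpairs q hq
    exact ⟨i, y, hi, rfl, (hsel i hi y).2 hq⟩
  · rintro ⟨i, y, hi, rfl, hy⟩
    exact (hsel i hi y).1 hy

end IsNeqTemplate

/-! ### Replacing `[x ≠ y]` by gadgets -/

section Gadgets

variable {σ : Template M} {C D E S : Set M.Num} {k : ℕ} {τ : Fin k → Template M}

/-- The pairs `(x, z)` such that the instance of `σ` at `x`, `z` is in `C`. -/
def edges (σ : Template M) (C : Set M.Num) : Set M.Num :=
  {p | ∃ x z, p = pair x z ∧ ∃ φ ∈ C, σ.IsInstance x z 0 0 φ}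

theorem pair_mem_edges {x z : M.Num} :
    pair x z ∈ edges σ C ↔ ∃ φ ∈ C, σ.IsInstance x z 0 0 φ :=
  exists_pair_eq_iff (P := fun x z => ∃ φ ∈ C, σ.IsInstance x z 0 0 φ)

theorem edges_mem_sets (σ : Template M) (hC : C ∈ M.sets) : edges σ C ∈ M.sets := by
  have := Fact.mk hC
  convert setOf_exists_mem
    (fun φ p => ∃ x ≤ p, ∃ z ≤ p, p = pair x z ∧ φ ∈ C ∧ σ.IsInstance x z 0 0 φ)
    (fun φ p => ∃ x ≤ p, ∃ z ≤ p, p = pair x z ∧ (σ.IsInstance x z 0 0 φ → φ ∈ C))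
    fun p => ⟨?_, fun h => ?_⟩ using 1
  · ext p
    constructor
    · rintro ⟨x, z, rfl, φ, hφ, h⟩
      exact ⟨φ, x, left_le_pair x z, z, right_le_pair x z, rfl, hφ, h⟩
    · rintro ⟨φ, x, -, z, -, rfl, hφ, h⟩
      exact ⟨x, z, rfl, φ, hφ, h⟩
  · rintro ⟨φ, x, hx, z, hz, rfl, hφ, h⟩ φ'
    exact ⟨x, hx, z, hz, rfl, fun h' => h.unique h' ▸ hφ⟩
  · obtain ⟨x, hx, z, hz, rfl, -⟩ := h 0
    obtain ⟨φ, hφ⟩ := Template.exists_isInstance σ x z 0 0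
    obtain ⟨x', -, z', -, hp, h'⟩ := h φ
    obtain ⟨rfl, rfl⟩ := pair_inj.1 hp
    exact ⟨φ, x, hx, z, hz, rfl, h' hφ, hφ⟩

theorem Template.exists_bound_isInstance (τ : Template M) (t f b : M.Num) :
    ∃ B, ∀ x ≤ b, ∀ z ≤ b, ∃ ψ < B, τ.IsInstance x z t f ψ := by
  obtain ⟨B, hB⟩ := collection
    (fun ψ p => ∀ x ≤ p, ∀ z ≤ p, p = pair x z → τ.IsInstance x z t f ψ) (pair b b + 1) (by
      intro p _
      by_cases hp : ∃ x z, p = pair x z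
      · obtain ⟨x, z, rfl⟩ := hp
        obtain ⟨ψ, hψ⟩ := exists_isInstance τ x z t f
        refine ⟨ψ, fun x' _ z' _ h => ?_⟩
        obtain ⟨rfl, rfl⟩ := pair_inj.1 h
        exact hψ
      · exact ⟨0, fun x _ z _ h => (hp ⟨x, z, h⟩).elim⟩)
  refine ⟨B, fun x hx z hz => ?_⟩
  obtain ⟨ψ, hψB, hψ⟩ := hB (pair x z) (Num.lt_add_one_iff.2 (pair_le_pair hx hz))
  exact ⟨ψ, hψB, hψ x (left_le_pair x z) z (right_le_pair x z) rfl⟩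

/-- The instances of the templates at the pairs in `E`. The variable `x` is renamed `x + x`, so that
`1` and `3` are fresh variables, standing for the constants. -/
def gadgets (τ : Fin k → Template M) (E : Set M.Num) : Set M.Num :=
  {ψ | ∃ j, ∃ x ≤ ψ, ∃ z ≤ ψ, ((τ j).IsConst ∨ pair x z ∈ E) ∧
    (τ j).IsInstance (x + x) (z + z) 1 (1 + 1 + 1) ψ}

theorem gadgets_mem_sets (hE : E ∈ M.sets) : gadgets τ E ∈ M.sets := by
  have := Fact.mk hE
  exact setOf_mem fun ψ => ∃ j, ∃ x ≤ ψ, ∃ z ≤ ψ, ((τ j).IsConst ∨ pair x z ∈ E) ∧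
    (τ j).IsInstance (x + x) (z + z) 1 (1 + 1 + 1) ψ

theorem isFormulaOver_of_mem_gadgets (hτ : ∀ j, (τ j).Admissible S) {ψ : M.Num}
    (hψ : ψ ∈ gadgets τ E) : IsFormulaOver S Set.univ ψ := by
  obtain ⟨j, x, -, z, -, -, h⟩ := hψ
  exact h.isFormulaOver (hτ j).mem (hτ j).isRel

theorem Template.IsInstance.mem_gadgets (hτ : ∀ j, (τ j).Admissible S) {x z ψ : M.Num}
    (hxz : pair x z ∈ E) {j : Fin k}
    (hψ : (τ j).IsInstance (x + x) (z + z) 1 (1 + 1 + 1) ψ) : ψ ∈ gadgets τ E := by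
  rcases (hτ j).isConst_or_mentions with hconst | ⟨⟨i, hi, hib, hic⟩, i', hi', hib', hic'⟩
  · exact ⟨j, 0, zero_le, 0, zero_le, .inl hconst, hψ.change_vars hconst _ _⟩
  · have hx : x + x < ψ := hψ.lt_of_select hi (.inr (.inr (.inl ⟨hib, hic, rfl⟩)))
    have hz : z + z < ψ := hψ.lt_of_select hi' (.inr (.inr (.inr ⟨hib', hic', rfl⟩)))
    exact ⟨j, x, le_self_add.trans hx.le, z, le_self_add.trans hz.le, .inr hxz, hψ⟩

/-- The assignment `ν` of the variables, transferred to the doubled variables and extended by the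
values `1` and `0` of the variables `1` and `3`. -/
def doubling (ν : Set M.Num) : Set M.Num := {y | y = 1 ∨ ∃ x ≤ y, y = x + x ∧ x ∈ ν}

variable {ν : Set M.Num}

theorem doubling_mem_sets (hν : ν ∈ M.sets) : doubling ν ∈ M.sets := by
  have := Fact.mk hν
  exact setOf_mem fun y => y = 1 ∨ ∃ x ≤ y, y = x + x ∧ x ∈ ν

theorem add_self_mem_doubling {y : M.Num} : y + y ∈ doubling ν ↔ y ∈ ν := by
  constructor
  · rintro (h | ⟨x, -, h, hx⟩)
    · exact absurd h (by simpa using Num.add_self_ne y 0)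
    · rwa [Num.add_self_inj.1 h]
  · exact fun hy => .inr ⟨y, le_self_add, rfl, hy⟩

theorem three_notMem_doubling : (1 + 1 + 1 : M.Num) ∉ doubling ν := by
  rintro (h | ⟨x, -, h, -⟩)
  · simp at h
  · exact Num.add_self_ne x 1 h.symm

theorem finSatisfiable_gadgets (hσ : IsNeqTemplate σ) (hτ : ∀ j, (τ j).Admissible S)
    (hC : C ∈ M.sets) (h : FinSatisfiable C) : FinSatisfiable (gadgets τ (edges σ C)) := by
  rintro D ⟨-, b, hDb⟩ hD
  obtain ⟨B, hB⟩ := σ.exists_bound_isInstance 0 0 b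
  obtain ⟨ν, hν, hmod⟩ := h.exists_isModelBelow hC true B
  have hne : ∀ x ≤ b, ∀ z ≤ b, pair x z ∈ edges σ C →
      ¬ (x ∈ polar true ν ↔ z ∈ polar true ν) := by
    intro x hx z hz hxz
    obtain ⟨φ, hφC, hφ⟩ := pair_mem_edges.1 hxz
    obtain ⟨φ', hφB, hφ'⟩ := hB x hx z hz
    obtain rfl := hφ.unique hφ'
    exact hσ.holds_iff.1 ((hφ.satisfies_iff _).1 (hmod φ hφB hφC))
  refine ⟨doubling (polar true ν), doubling_mem_sets (polar_mem_sets true hν), fun ψ hψ => ?_⟩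
  obtain ⟨j, x, hx, z, hz, hxz, hψx⟩ := hD hψ
  have hψb : ψ ≤ b := (hDb ψ hψ).le
  have h_one : (1 : M.Num) ∈ doubling (polar true ν) := .inl rfl
  simpa only [hψx.satisfies_iff, add_self_mem_doubling, three_notMem_doubling, h_one] using
    (hτ j).holds (hxz.imp_right (hne x (hx.trans hψb) z (hz.trans hψb)))

theorem isHomogeneous_of_gadgets (hσ : IsNeqTemplate σ) (hτ : ∀ j, (τ j).Admissible S)
    (hneq : ∀ X Z T F, (∀ j, (τ j).Holds X Z T F) → ¬ (X ↔ Z)) (hC : C ∈ M.sets) {V H : Set M.Num}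
    (hform : ∀ φ ∈ C, IsFormulaOver (M.codesOf {BoolRel.neq}) V φ)
    (h : IsHomogeneous (gadgets τ (edges σ C)) H) : IsHomogeneous C {x | x + x ∈ H} := by
  obtain ⟨v, hv⟩ := h
  refine ⟨v, fun D ⟨_, b, hDb⟩ hDC => ?_⟩
  choose B hB using fun j => (τ j).exists_bound_isInstance 1 (1 + 1 + 1) (b + b)
  have := Fact.mk (gadgets_mem_sets (τ := τ) (edges_mem_sets σ hC))
  obtain ⟨ν, hν, hmod, hνH⟩ := hv {ψ | ψ ∈ gadgets τ (edges σ C) ∧ ψ < ∑ j, B j}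
    ⟨setOf_mem fun ψ => ψ ∈ gadgets τ (edges σ C) ∧ ψ < ∑ j, B j, _, fun ψ hψ => hψ.2⟩
    fun ψ hψ => hψ.1
  have := Fact.mk hν
  refine ⟨{x | x + x ∈ ν}, setOf_mem fun x => x + x ∈ ν, fun φ hφ => ?_, fun x hx => hνH _ hx⟩
  obtain ⟨x, hx, z, hz, hφx⟩ := hσ.exists_isInstance_of_isFormulaOver (hform φ (hDC hφ))
  have hxz : pair x z ∈ edges σ C := pair_mem_edges.2 ⟨φ, hDC hφ, hφx⟩
  have hxb : x ≤ b := (hx.trans (hDb φ hφ)).le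
  have hzb : z ≤ b := (hz.trans (hDb φ hφ)).le
  rw [hφx.satisfies_iff, hσ.holds_iff]
  refine hneq _ _ (1 ∈ ν) (1 + 1 + 1 ∈ ν) fun j => ?_
  obtain ⟨ψ, hψB, hψ⟩ := hB j (x + x) (add_le_add hxb hxb) (z + z) (add_le_add hzb hzb)
  exact (hψ.satisfies_iff ν).1 (hmod ψ ⟨hψ.mem_gadgets hτ hxz, hψB.trans_le
    (Finset.single_le_sum (fun _ _ => zero_le) (Finset.mem_univ j))⟩)

theorem lrsat_neq_of_templates (hτ : ∀ j, (τ j).Admissible S)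
    (hneq : ∀ X Z T F, (∀ j, (τ j).Holds X Z T F) → ¬ (X ↔ Z)) (h : M.LRSAT S) :
    M.LRSAT (M.codesOf {BoolRel.neq}) := by
  intro V _ C hC L hL _ _ hLinf hform hsat
  obtain ⟨σ, hσ⟩ := exists_isNeqTemplate (M := M)
  have := Fact.mk hL
  obtain ⟨H, hH, hHL, hHinf, hHhom⟩ := h Set.univ univ_mem_sets
    (gadgets τ (edges σ C)) (gadgets_mem_sets (edges_mem_sets σ hC))
    {y | ∃ x ≤ y, y = x + x ∧ x ∈ L} (setOf_mem fun y => ∃ x ≤ y, y = x + x ∧ x ∈ L)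
    (fun b => ⟨b + 1, trivial, lt_add_one b⟩) (Set.subset_univ _)
    (fun b => by
      obtain ⟨x, hx, hbx⟩ := hLinf b
      exact ⟨x + x, ⟨x, le_self_add, rfl, hx⟩, hbx.trans_le le_self_add⟩)
    (fun ψ => isFormulaOver_of_mem_gadgets hτ) (finSatisfiable_gadgets hσ hτ hC hsat)
  have := Fact.mk hH
  refine ⟨{x | x + x ∈ H}, setOf_mem fun x => x + x ∈ H, fun x hx => ?_, fun b => ?_,
    isHomogeneous_of_gadgets hσ hτ hneq hC hform hHhom⟩
  · obtain ⟨y, -, hy, hyL⟩ := hHL hx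
    rwa [Num.add_self_inj.1 hy]
  · obtain ⟨y, hy, hby⟩ := hHinf (b + b)
    obtain ⟨x, -, rfl, -⟩ := hHL hy
    exact ⟨x, hy, lt_of_not_ge fun hle => (add_le_add hle hle).not_gt hby⟩

end Gadgets

/-! ### Classes that are not tame -/

theorem IsVec.exists_lt_of_not_valueSet_subset {p : Bool} {n a b : M.Num} (ha : IsVec n a)
    (hb : IsVec n b) (h : ¬ valueSet p a ⊆ valueSet p b) :
    ∃ i < n, i ∈ valueSet p a ∧ i ∉ valueSet p b := by
  obtain ⟨i, ⟨hi, hia⟩, hib⟩ := Set.not_subset.1 (mt (ha.valueSet_subset_iff hb).2 h)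
  exact ⟨i, hi, hia, hib⟩

theorem Template.mentions_of_not_valueSet_subset {p : Bool} {τ : Template M} (hb : IsVec τ.n τ.b)
    (hc : IsVec τ.n τ.c) (hbc : ¬ valueSet p τ.b ⊆ valueSet p τ.c)
    (hcb : ¬ valueSet p τ.c ⊆ valueSet p τ.b) : τ.Mentions := by
  obtain ⟨i, hi, hib, hic⟩ := hb.exists_lt_of_not_valueSet_subset hc hbc
  obtain ⟨j, hj, hjc, hjb⟩ := hc.exists_lt_of_not_valueSet_subset hb hcb
  cases p <;> simp only [mem_valueSet, iff_true, Bool.false_eq_true, iff_false, not_not] at *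
  exacts [⟨⟨j, hj, hjb, hjc⟩, i, hi, hib, hic⟩, ⟨⟨i, hi, hib, hic⟩, j, hj, hjb, hjc⟩]

theorem exists_admissible_of_not_polarHorn {p : Bool} {S : Set M.Num} {n r : M.Num}
    (hS : pair n r ∈ S) (hrel : IsRel (pair n r)) (h : ¬ PolarHorn p n r) :
    ∃ τ : Template M, τ.Admissible S ∧ ¬ τ.Holds (p = false) (p = false) True False := by
  have hvec := (isRel_pair.1 hrel).2
  rw [polarHorn_iff_polarClosed hrel] at h
  simp only [PolarClosed, not_forall] at h
  obtain ⟨a, b, c, ha, hb, hc, hcab, hcr⟩ := h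
  have hab : ¬ valueSet p a ⊆ valueSet p b := fun hab => hcr <| by
    rwa [hc.eq_of_valueSet (hvec a ha) (hcab.trans (Set.inter_eq_left.2 hab))]
  have hba : ¬ valueSet p b ⊆ valueSet p a := fun hba => hcr <| by
    rwa [hc.eq_of_valueSet (hvec b hb) (hcab.trans (Set.inter_eq_right.2 hba))]
  refine ⟨⟨n, r, a, b⟩, ⟨hS, hrel, ha, hb,
    .inr (Template.mentions_of_not_valueSet_subset (hvec a ha) (hvec b hb) hab hba)⟩, ?_⟩
  rintro ⟨d, hd, hdi⟩
  refine hcr ((hc.eq (hvec d hd) fun i hi => ?_) ▸ hd)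
  have hi_iff := Set.ext_iff.1 hcab i
  rw [hdi i hi]
  cases p <;> simp only [Set.mem_inter_iff, mem_valueSet, Template.Select] at hi_iff ⊢ <;>
    simp at hi_iff ⊢ <;> tauto

/-- Some gadget excludes the values `x = z = p`, whatever the values of `t` and `f`. -/
def ExcludesDiagonal (p : Bool) (S : Set M.Num) : Prop :=
  ∃ α : Template M, α.Admissible S ∧
    ∀ X Z T F, α.Holds X Z T F → ¬ ((X ↔ p = true) ∧ (Z ↔ p = true))

omit hM in
theorem exists_admissible_of_not_relValid {p : Bool} {S : Set M.Num} {ρ : M.Num} (hS : ρ ∈ S)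
    (hrel : IsRel ρ) (hne : RelNonempty ρ) (h : ¬ RelValid p ρ) :
    ∃ δ : Template M, δ.Admissible S ∧
      (∀ X Z T F, δ.Holds X Z T F → ¬ ((T ↔ p = true) ∧ (F ↔ p = true))) ∧
      ((∀ X Z T F, δ.Holds X Z T F → T ∨ ¬ F) ∨ ExcludesDiagonal p S) := by
  obtain ⟨n, r, rfl, a, ha⟩ := hne
  have not_const (b : M.Num) (hb : InCode b r) : ∃ i < n, i ∉ valueSet p b := by
    by_contra! hconst
    exact h ⟨n, r, rfl, b, hb, hconst⟩
  refine ⟨⟨n, r, a, a⟩, ⟨hS, hrel, ha, ha, .inl fun _ _ => Iff.rfl⟩, ?_, ?_⟩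
  · rintro X Z T F ⟨d, hd, hdi⟩ ⟨hT, hF⟩
    obtain ⟨i, hi, hid⟩ := not_const d hd
    refine hid ((hdi i hi).trans ?_)
    unfold Template.Select
    tauto
  · by_cases hanti : ∃ b, InCode b r ∧ ∀ i < n, (InCode i b ↔ ¬ InCode i a)
    · obtain ⟨b, hb, hab⟩ := hanti
      obtain ⟨i, hi, hia⟩ := not_const a ha
      obtain ⟨j, hj, hjb⟩ := not_const b hb
      refine .inr ⟨⟨n, r, a, b⟩, ⟨hS, hrel, ha, hb, .inr ?_⟩, ?_⟩
      · have := hab i hi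
        have := hab j hj
        cases p <;> simp only [mem_valueSet, iff_true, Bool.false_eq_true, iff_false,
          not_not] at hia hjb
        exacts [⟨⟨i, hi, by tauto⟩, j, hj, by tauto⟩, ⟨⟨j, hj, by tauto⟩, i, hi, by tauto⟩]
      · rintro X Z T F ⟨d, hd, hdi⟩ ⟨hX, hZ⟩
        obtain ⟨k, hk, hkd⟩ := not_const d hd
        refine hkd ((hdi k hk).trans ?_)
        have := hab k hk
        unfold Template.Select
        tauto
    · refine .inl fun X Z T F ⟨d, hd, hdi⟩ => ?_
      by_contra hTF
      refine hanti ⟨d, hd, fun i hi => (hdi i hi).trans ?_⟩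
      unfold Template.Select
      tauto

theorem lrsat_neq_of_excludesDiagonal {S : Set M.Num} (h₀ : ExcludesDiagonal false S)
    (h₁ : ExcludesDiagonal true S) (h : M.LRSAT S) : M.LRSAT (M.codesOf {BoolRel.neq}) := by
  obtain ⟨α₀, hα₀, hXZ₀⟩ := h₀
  obtain ⟨α₁, hα₁, hXZ₁⟩ := h₁
  refine lrsat_neq_of_templates (τ := ![α₀, α₁]) (Fin.forall_fin_two.2 ⟨hα₀, hα₁⟩)
    (fun X Z T F hτ hXZ => ?_) h
  by_cases hX : X
  · exact hXZ₁ X Z T F (hτ 1) (by simp [hX, hXZ.1 hX])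
  · exact hXZ₀ X Z T F (hτ 0) (by simp [hX, mt hXZ.2 hX])

theorem lrsat_neq_of_forces_constants {S : Set M.Num} {δ₀ δ₁ η κ : Template M}
    (hδ₀ : δ₀.Admissible S) (hδ₁ : δ₁.Admissible S) (hη : η.Admissible S) (hκ : κ.Admissible S)
    (hTF : ∀ X Z T F, δ₀.Holds X Z T F → δ₁.Holds X Z T F → T ∧ ¬ F)
    (hη' : ¬ η.Holds False False True False) (hκ' : ¬ κ.Holds True True True False)
    (h : M.LRSAT S) : M.LRSAT (M.codesOf {BoolRel.neq}) := by
  refine lrsat_neq_of_templates (τ := ![δ₀, δ₁, η, κ]) ?_ (fun X Z T F hτ hXZ => ?_) h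
  · simp only [Fin.forall_fin_succ, IsEmpty.forall_iff, and_true]
    exact ⟨hδ₀, hδ₁, hη, hκ⟩
  · obtain ⟨hT, hF⟩ := hTF X Z T F (hτ 0) (hτ 1)
    have hη : η.Holds X Z T F := hτ 2
    have hκ : κ.Holds X Z T F := hτ 3
    by_cases hX : X
    · exact hκ' (by simpa only [hX, hXZ.1 hX, hT, hF] using hκ)
    · exact hη' (by simpa only [hX, mt hXZ.2 hX, hT, hF] using hη)

theorem lrsat_neq_of_not_relTame {S : Set M.Num} (hrel : ∀ ρ ∈ S, IsRel ρ)
    (hne : ∀ ρ ∈ S, RelNonempty ρ) (hS : ¬ RelTame S) (h : M.LRSAT S) :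
    M.LRSAT (M.codesOf {BoolRel.neq}) := by
  unfold RelTame at hS
  push Not at hS
  obtain ⟨⟨ρ₀, hρ₀, h₀⟩, ⟨ρ₁, hρ₁, h₁⟩, ⟨ρ₂, hρ₂, h₂⟩, ρ₃, hρ₃, h₃⟩ := hS
  obtain ⟨n₂, r₂, rfl, -⟩ := hne _ hρ₂
  obtain ⟨n₃, r₃, rfl, -⟩ := hne _ hρ₃
  obtain ⟨δ₀, hδ₀, hdiff₀, h₀⟩ :=
    exists_admissible_of_not_relValid hρ₀ (hrel _ hρ₀) (hne _ hρ₀) (mt relValid_false.1 h₀)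
  obtain ⟨δ₁, hδ₁, hdiff₁, h₁⟩ :=
    exists_admissible_of_not_relValid hρ₁ (hrel _ hρ₁) (hne _ hρ₁) (mt relValid_true.1 h₁)
  obtain ⟨η, hη, hη'⟩ :=
    exists_admissible_of_not_polarHorn hρ₂ (hrel _ hρ₂) (mt relHorn_pair.2 h₂)
  obtain ⟨κ, hκ, hκ'⟩ :=
    exists_admissible_of_not_polarHorn hρ₃ (hrel _ hρ₃) (mt relCoHorn_pair.2 h₃)
  by_cases hdiag : ExcludesDiagonal false S ∧ ExcludesDiagonal true S
  · exact lrsat_neq_of_excludesDiagonal hdiag.1 hdiag.2 h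
  have hTF (X Z T F : Prop) (hT₀ : δ₀.Holds X Z T F) (hT₁ : δ₁.Holds X Z T F) : T ∧ ¬ F := by
    have hne₀ : ¬ (¬ T ∧ ¬ F) := by simpa using hdiff₀ X Z T F hT₀
    have hne₁ : ¬ (T ∧ F) := by simpa using hdiff₁ X Z T F hT₁
    have hor : T ∨ ¬ F := by
      rcases not_and_or.1 hdiag with hdiag | hdiag
      exacts [h₀.resolve_right hdiag X Z T F hT₀, h₁.resolve_right hdiag X Z T F hT₁]
    tauto
  exact lrsat_neq_of_forces_constants hδ₀ hδ₁ hη hκ hTF (by simpa using hη') (by simpa using hκ') h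

/-! ### Properties of standard relations and of their codes -/

omit hM in
theorem Codes.relNonempty {ρ : M.Num} {R : BoolRel} (h : Codes ρ R) (hR : R.carrier.Nonempty) :
    RelNonempty ρ := by
  obtain ⟨-, r, rfl, hr⟩ := h
  obtain ⟨v, hv⟩ := hR
  obtain ⟨a, ha, -⟩ := (hr v).1 hv
  exact ⟨_, r, rfl, a, ha⟩

theorem Codes.relValid_iff {p : Bool} {ρ : M.Num} {R : BoolRel} (h : Codes ρ R) :
    RelValid p ρ ↔ R.IsValid p := by
  obtain ⟨-, r, rfl, hr⟩ := h
  rw [BoolRel.IsValid, hr]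
  unfold RelValid
  rw [exists_pair_eq_iff (P := fun n r => ∃ a, InCode a r ∧ ∀ i, i < n → i ∈ valueSet p a)]
  refine exists_congr fun a => and_congr_right fun _ => ?_
  simp only [lt_num_iff, forall_exists_index, forall_eq_apply_imp_iff, mem_valueSet]

/-- The number `c` codes the clause `C`. -/
def CodesClause {n : ℕ} (c : M.Num) (C : BoolClause n) : Prop :=
  ∃ k l, c = pair k l ∧ (∀ x, InCode x k ↔ ∃ i ∈ C.pos, x = M.num i) ∧
    ∀ x, InCode x l ↔ ∃ i ∈ C.neg, x = M.num i

theorem exists_codesClause {n : ℕ} (C : BoolClause n) : ∃ c : M.Num, CodesClause c C := by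
  obtain ⟨k, -, hk⟩ := exists_finCode_of_finset (M := M) C.pos
  obtain ⟨l, -, hl⟩ := exists_finCode_of_finset (M := M) C.neg
  exact ⟨_, k, l, rfl, hk, hl⟩

theorem exists_finset_of_forall_lt_num {n : ℕ} {k : M.Num} (hk : ∀ x, InCode x k → x < M.num n) :
    ∃ s : Finset (Fin n), ∀ x, InCode x k ↔ ∃ i ∈ s, x = M.num i := by
  classical
  refine ⟨Finset.univ.filter fun i => InCode (M.num i) k, fun x => ⟨fun hx => ?_, ?_⟩⟩
  · obtain ⟨i, rfl⟩ := lt_num_iff.1 (hk x hx)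
    exact ⟨i, by simpa using hx, rfl⟩
  · rintro ⟨i, hi, rfl⟩
    simpa using hi

theorem forall_inCode_eq_iff_card_le_one {n : ℕ} {k : M.Num} {s : Finset (Fin n)}
    (hk : ∀ x, InCode x k ↔ ∃ i ∈ s, x = M.num i) :
    (∀ x y, InCode x k → InCode y k → x = y) ↔ s.card ≤ 1 := by
  simp only [Finset.card_le_one, hk]
  constructor
  · exact fun h i hi j hj => Fin.ext (num_strictMono.injective (h _ _ ⟨i, hi, rfl⟩ ⟨j, hj, rfl⟩))
  · rintro h _ _ ⟨i, hi, rfl⟩ ⟨j, hj, rfl⟩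
    rw [h i hi j hj]

theorem IsClause.exists_codesClause {n : ℕ} {c : M.Num} (h : IsClause (M.num n) c) :
    ∃ C : BoolClause n, CodesClause c C := by
  obtain ⟨k, l, rfl, hk, hl⟩ := h
  obtain ⟨s, hs⟩ := exists_finset_of_forall_lt_num hk
  obtain ⟨t, ht⟩ := exists_finset_of_forall_lt_num hl
  exact ⟨⟨s, t⟩, k, l, rfl, hs, ht⟩

namespace CodesClause

variable {n : ℕ} {c : M.Num} {C : BoolClause n}

theorem isClause (h : CodesClause c C) : IsClause (M.num n) c := by
  obtain ⟨k, l, rfl, hk, hl⟩ := h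
  refine ⟨k, l, rfl, fun x hx => ?_, fun x hx => ?_⟩
  · obtain ⟨i, -, hi⟩ := (hk x).1 hx
    exact lt_num_iff.2 ⟨i, hi⟩
  · obtain ⟨i, -, hi⟩ := (hl x).1 hx
    exact lt_num_iff.2 ⟨i, hi⟩

theorem clauseHolds_iff (h : CodesClause c C) {a : M.Num} {v : Fin n → Bool}
    (hav : ∀ i : Fin n, InCode (M.num i) a ↔ v i = true) : ClauseHolds c a ↔ C.Holds v := by
  obtain ⟨k, l, rfl, hk, hl⟩ := h
  simp [ClauseHolds, exists_pair_eq_iff, BoolClause.Holds, hk, hl, ← hav, ← Bool.not_eq_true]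

theorem hornClause_iff (h : CodesClause c C) : HornClause c ↔ C.IsHorn := by
  obtain ⟨k, l, rfl, hk, -⟩ := h
  exact exists_pair_eq_iff.trans (forall_inCode_eq_iff_card_le_one hk)

theorem coHornClause_iff (h : CodesClause c C) : CoHornClause c ↔ C.IsCoHorn := by
  obtain ⟨k, l, rfl, -, hl⟩ := h
  exact exists_pair_eq_iff.trans (forall_inCode_eq_iff_card_le_one hl)

end CodesClause

theorem finite_boolClause (n : ℕ) : Finite (BoolClause n) :=
  .of_injective (fun C => (C.pos, C.neg)) fun ⟨_, _⟩ ⟨_, _⟩ h => by simpa using h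

theorem Codes.exists_clauses_iff {R : BoolRel} {r : M.Num} (h : Codes (pair (M.num R.arity) r) R)
    {P : M.Num → Prop} {Q : BoolClause R.arity → Prop}
    (hPQ : ∀ {c C}, CodesClause c C → (P c ↔ Q C)) :
    (∃ f, (∀ c, InCode c f → IsClause (M.num R.arity) c ∧ P c) ∧
      ∀ a, IsVec (M.num R.arity) a → (InCode a r ↔ ∀ c, InCode c f → ClauseHolds c a)) ↔
    ∃ F : Finset (BoolClause R.arity),
      (∀ C ∈ F, Q C) ∧ ∀ v, v ∈ R.carrier ↔ ∀ C ∈ F, C.Holds v := by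
  obtain ⟨r', hr', hrel, hr⟩ := h.exists_eq
  obtain rfl := (pair_inj.1 hr').2
  constructor
  · rintro ⟨f, hf, hfr⟩
    have := finite_boolClause R.arity
    refine ⟨(Set.toFinite {C | ∃ c, InCode c f ∧ CodesClause c C}).toFinset, ?_, fun v => ?_⟩
    · simp only [Set.Finite.mem_toFinset]
      rintro C ⟨c, hc, hcC⟩
      exact (hPQ hcC).1 (hf c hc).2
    · simp only [Set.Finite.mem_toFinset]
      obtain ⟨a, ha, hav⟩ := exists_vec_num (M := M) v
      rw [← hr a v ha hav, hfr a ha]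
      refine ⟨fun hfa C ⟨c, hc, hcC⟩ => (hcC.clauseHolds_iff hav).1 (hfa c hc), fun hv c hc => ?_⟩
      obtain ⟨C, hcC⟩ := (hf c hc).1.exists_codesClause
      exact (hcC.clauseHolds_iff hav).2 (hv C ⟨c, hc, hcC⟩)
  · rintro ⟨F, hF, hFR⟩
    choose code hcode using exists_codesClause (M := M) (n := R.arity)
    obtain ⟨f, -, hf⟩ := exists_finCode_of_finite (F.finite_toSet.image code)
    refine ⟨f, fun c hc => ?_, fun a ha => ?_⟩
    · obtain ⟨C, hC, rfl⟩ := (hf c).1 hc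
      exact ⟨(hcode C).isClause, (hPQ (hcode C)).2 (hF C hC)⟩
    · obtain ⟨v, hav⟩ := exists_boolVec a R.arity
      simp only [hr a v ha hav, hFR, hf, Set.forall_mem_image, Finset.mem_coe,
        (hcode _).clauseHolds_iff hav]

theorem Codes.relHorn_iff {ρ : M.Num} {R : BoolRel} (h : Codes ρ R) : RelHorn ρ ↔ R.IsHorn := by
  obtain ⟨r, rfl, -⟩ := h.2
  exact exists_pair_eq_iff.trans (h.exists_clauses_iff CodesClause.hornClause_iff)

theorem Codes.relCoHorn_iff {ρ : M.Num} {R : BoolRel} (h : Codes ρ R) :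
    RelCoHorn ρ ↔ R.IsCoHorn := by
  obtain ⟨r, rfl, -⟩ := h.2
  exact exists_pair_eq_iff.trans (h.exists_clauses_iff CodesClause.coHornClause_iff)

theorem forall_codesOf {S : Set BoolRel} {P : M.Num → Prop} {Q : BoolRel → Prop}
    (h : ∀ {ρ R}, Codes ρ R → (P ρ ↔ Q R)) : (∀ ρ ∈ M.codesOf S, P ρ) ↔ ∀ R ∈ S, Q R := by
  constructor
  · intro hP R hR
    obtain ⟨ρ, hρ⟩ := exists_codes (M := M) R
    exact (h hρ).1 (hP ρ ⟨R, hR, hρ⟩)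
  · rintro hQ ρ ⟨R, hR, hρ⟩
    exact (h hρ).2 (hQ R hR)

theorem relTame_codesOf_iff {S : Set BoolRel} : RelTame (M.codesOf S) ↔ BoolRel.Tame S := by
  simp only [RelTame, ← relValid_false, ← relValid_true, BoolRel.Tame,
    forall_codesOf Codes.relValid_iff, forall_codesOf Codes.relHorn_iff,
    forall_codesOf Codes.relCoHorn_iff]

end L2Structure

theorem theorem3p4 :
    (∀ S : Set BoolRel,
      (BoolRel.Tame S → RCA₀Proves.{u} fun M => M.LRSAT (M.codesOf S)) ∧
      ((∀ R ∈ S, R.carrier.Nonempty) → ¬ BoolRel.Tame S →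
        RCA₀Proves.{u} fun M => M.LRSAT (M.codesOf S) → M.LRSAT (M.codesOf {BoolRel.neq}))) ∧
    (RCA₀Proves.{u} fun M => ∀ S : Set M.Num, (∀ ρ ∈ S, L2Structure.IsRel ρ) →
      (L2Structure.RelTame S → M.LRSAT S) ∧
      ((∀ ρ ∈ S, L2Structure.RelNonempty ρ) → ¬ L2Structure.RelTame S →
        M.LRSAT S → M.LRSAT (M.codesOf {BoolRel.neq}))) := by
  refine ⟨fun S => ⟨fun hS M hM => ?_, fun hne hS M hM => ?_⟩, fun M hM S hrel => ?_⟩ <;>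
    have := Fact.mk hM
  · exact L2Structure.lrsat_of_relTame (L2Structure.relTame_codesOf_iff.2 hS)
  · exact L2Structure.lrsat_neq_of_not_relTame (fun _ ⟨_, _, hρ⟩ => hρ.1)
      (fun _ ⟨R, hR, hρ⟩ => hρ.relNonempty (hne R hR))
      (mt L2Structure.relTame_codesOf_iff.1 hS)
  · exact ⟨L2Structure.lrsat_of_relTame, L2Structure.lrsat_neq_of_not_relTame hrel⟩
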